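/- Let $\mathcal D\subset\mathbb R^2$ be open, let $2\le n\le\infty$, and let $\lambda=\lambda(u,v)$ be a $C^n$ solution on $\mathcal D$ of the hyperbolic sine-Gordon equation $$\Delta^h\lambda:=\lambda_{uu}-\lambda_{vv}=\sin\lambda,\qquad 0<\lambda<\frac{\pi}{2},\qquad \lambda_u\lambda_v\neq 0 \quad\text{on } \mathcal D .$$ For an immersion $x=x(u,v)$ into Euclidean space $\mathbb R^3$ with unit normal $l=\frac{x_u\times x_v}{|x_u\times x_v|}$, let $E,F,G$ and $L,M,N$ be the coefficients of the first and second fundamental forms. The parameters $(u,v)$ are called principal if $F=M=0$; in that case the invariants of the surface are the principal curvatures and the geodesic curvatures of the principal lines, $$\nu_1=\frac LE,\qquad \nu_2=\frac NG,\qquad \gamma_1=-\frac{E_v}{2E\sqrt G},\qquad \gamma_2=\frac{G_u}{2G\sqrt E},$$ and the surface is called strongly regular if $(\nu_1-\nu_2)\gamma_1\gamma_2\neq0$ everywhere. Consider strongly regular surfaces in principal parameters $(u,v)$ with Gaussian curvature $K=-1$ and invariants $$\nu_1=\tan\frac\lambda2,\qquad \nu_2=-\cot\frac\lambda2,\qquad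 \gamma_1=\frac{\lambda_v}{2\cos\frac\lambda2},\qquad \gamma_2=\frac{\lambda_u}{2\sin\frac\lambda2}.\tag{$*$}$$ 1. (Existence) Every point of $\mathcal D$ has a connected open neighbourhood $\mathcal D_0\subset\mathcal D$ on which there is such a surface, of class $C^{n+1}$ (with $C^{\infty}$ for $n=\infty$). 2. (Uniqueness up to a motion) If $x$ is such a surface of class $C^3$ on a connected open set $\mathcal D_0\subset\mathcal D$, then a map $y:\mathcal D_0\to\mathbb R^3$ is such a surface of class $C^3$ if and only if $y=T\circ x$ for a motion $T$ of $\mathbb R^3$, that is, $T(a)=Aa+b$ with $A\in SO(3)$ and $b\in\mathbb R^3$. -/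

import Mathlib

open scoped RealInnerProductSpace

noncomputable section

namespace SurfaceTheory

/-- Euclidean three-space with its standard inner product. -/
abbrev E3 : Type := EuclideanSpace ℝ (Fin 3)

/-- The vector product of Euclidean three-space (with its standard orientation). -/
def cross (a b : E3) : E3 := WithLp.toLp 2 (crossProduct a.ofLp b.ofLp)

/-! Partial derivatives of a function of the two parameters `(u, v)`. -/

section Partial

variable {V : Type*} [NormedAddCommGroup V] [NormedSpace ℝ V]

/-- The partial derivative with respect to the first parameter `u`. -/
def du (f : ℝ × ℝ → V) (p : ℝ × ℝ) : V := fderiv ℝ f p (1, 0)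

/-- The partial derivative with respect to the second parameter `v`. -/
def dv (f : ℝ × ℝ → V) (p : ℝ × ℝ) : V := fderiv ℝ f p (0, 1)

end Partial

/-- The hyperbolic Laplacian `f_uu - f_vv`. -/
def hypLaplacian (f : ℝ × ℝ → ℝ) (p : ℝ × ℝ) : ℝ := du (du f) p - dv (dv f) p

/-! The two fundamental forms of a parametrized surface `x = x(u, v)`. -/

/-- The unit normal `l`, chosen so that `x_u, x_v, l` is right oriented. -/
def unitNormal (x : ℝ × ℝ → E3) (p : ℝ × ℝ) : E3 :=
  ‖cross (du x p) (dv x p)‖⁻¹ • cross (du x p) (dv x p)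

def coeffE (x : ℝ × ℝ → E3) (p : ℝ × ℝ) : ℝ := ⟪du x p, du x p⟫

def coeffF (x : ℝ × ℝ → E3) (p : ℝ × ℝ) : ℝ := ⟪du x p, dv x p⟫

def coeffG (x : ℝ × ℝ → E3) (p : ℝ × ℝ) : ℝ := ⟪dv x p, dv x p⟫

def coeffL (x : ℝ × ℝ → E3) (p : ℝ × ℝ) : ℝ := ⟪du (du x) p, unitNormal x p⟫

def coeffM (x : ℝ × ℝ → E3) (p : ℝ × ℝ) : ℝ := ⟪dv (du x) p, unitNormal x p⟫

def coeffN (x : ℝ × ℝ → E3) (p : ℝ × ℝ) : ℝ := ⟪dv (dv x) p, unitNormal x p⟫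

/-- The Gaussian curvature, in arbitrary parameters. -/
def gaussCurvature (x : ℝ × ℝ → E3) (p : ℝ × ℝ) : ℝ :=
  (coeffL x p * coeffN x p - coeffM x p ^ 2) / (coeffE x p * coeffG x p - coeffF x p ^ 2)

/-! The four invariants of a surface in principal parameters. -/

/-- The principal curvature along the lines `v = const`. -/
def nu₁ (x : ℝ × ℝ → E3) (p : ℝ × ℝ) : ℝ := coeffL x p / coeffE x p

/-- The principal curvature along the lines `u = const`. -/
def nu₂ (x : ℝ × ℝ → E3) (p : ℝ × ℝ) : ℝ := coeffN x p / coeffG x p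

/-- The geodesic curvature of the principal lines `v = const`. -/
def gamma₁ (x : ℝ × ℝ → E3) (p : ℝ × ℝ) : ℝ :=
  -(dv (coeffE x) p) / (2 * coeffE x p * Real.sqrt (coeffG x p))

/-- The geodesic curvature of the principal lines `u = const`. -/
def gamma₂ (x : ℝ × ℝ → E3) (p : ℝ × ℝ) : ℝ :=
  du (coeffG x) p / (2 * coeffG x p * Real.sqrt (coeffE x p))

/-- `x` is a strongly regular surface of class `C^k` on the parameter domain `D`,
parametrized by principal parameters: `x` is an immersion of class `C^k`, the parametric
net is principal, and `(ν₁ - ν₂) γ₁ γ₂` vanishes nowhere (so there are no umbilics). -/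
structure IsStronglyRegularSurface (k : ℕ∞) (x : ℝ × ℝ → E3) (D : Set (ℝ × ℝ)) : Prop where
  contDiffOn : ContDiffOn ℝ k x D
  immersion : ∀ p ∈ D, LinearIndependent ℝ ![du x p, dv x p]
  coeffF_eq_zero : ∀ p ∈ D, coeffF x p = 0
  coeffM_eq_zero : ∀ p ∈ D, coeffM x p = 0
  strongly_regular : ∀ p ∈ D, (nu₁ x p - nu₂ x p) * gamma₁ x p * gamma₂ x p ≠ 0

/-- `x` is a strongly regular surface of class `C^k` on `D`, in principal parameters, of
Gaussian curvature `-1` and with the four invariants prescribed by the function `lam`. -/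
structure IsGeneratedBy (k : ℕ∞) (lam : ℝ × ℝ → ℝ) (x : ℝ × ℝ → E3)
    (D : Set (ℝ × ℝ)) : Prop where
  surface : IsStronglyRegularSurface k x D
  gaussCurvature_eq : ∀ p ∈ D, gaussCurvature x p = -1
  nu₁_eq : ∀ p ∈ D, nu₁ x p = Real.tan (lam p / 2)
  nu₂_eq : ∀ p ∈ D, nu₂ x p = -Real.cot (lam p / 2)
  gamma₁_eq : ∀ p ∈ D, gamma₁ x p = dv lam p / (2 * Real.cos (lam p / 2))
  gamma₂_eq : ∀ p ∈ D, gamma₂ x p = du lam p / (2 * Real.sin (lam p / 2))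

/-- A motion of Euclidean three-space: a rotation (a linear isometry of determinant one)
followed by a translation. -/
def IsMotion (T : E3 → E3) : Prop :=
  ∃ (A : E3 ≃ₗᵢ[ℝ] E3) (b : E3),
    LinearMap.det (A.toLinearEquiv : E3 →ₗ[ℝ] E3) = 1 ∧ ∀ a, T a = A a + b

end SurfaceTheory

end

/-! Put c = cos(λ/2), s = sin(λ/2). A surface with x_u = cX, x_v = sY, where X, Y, l is an oriented
orthonormal frame, has the invariants (∗) as soon as the frame satisfies the equations of
`IsMovingFrame`. These equations, together with those for x, form a linear system F_u = AF, F_v = BF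
for F = (X, Y, l, x). Its integrability condition A_v + AB = B_u + BA reduces to λ_uu - λ_vv = 2sc =
sin λ (`frameCoeff_compatible`).

Existence: a compatible linear system is locally solvable (`exists_solution_of_compatible`), the
skew form of the frame equations keeps the frame orthonormal and oriented
(`IsMovingFrame.isOrientedFrame`), and `isGeneratedBy_of_isMovingFrame` reads off the invariants.
The coefficients contain first derivatives of λ, so they are only C^(n-1), and for n = 2 only C¹.
Solutions F are then C^n, and x gains one more class because x_u and x_v involve λ but not its
derivatives.

Uniqueness: the invariants do not prescribe E and G directly; they have to be recovered. The
principal curvatures give l_u = -(s/c) x_u and l_v = (c/s) x_v. Equality of the mixed derivatives of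
l (Codazzi) determines x_uv, hence E_v/E and G_u/G in terms of λ. Comparison with the prescribed γ₁
and γ₂, after cancelling λ_v ≠ 0 and λ_u ≠ 0, gives √G = s and √E = c
(`IsGeneratedBy.exists_isMovingFrame`). Thus every such surface comes from a frame solving one fixed
linear system. A rotation matches two such frames at one point, hence everywhere, and the surfaces
then differ by a translation (`IsGeneratedBy.exists_motion`). -/

namespace SurfaceTheory

open Filter Topology Metric Set

/-! ### Linear differential equations depending on a parameter. -/

section LinearSystem

variable {W : Type*} [NormedAddCommGroup W] [NormedSpace ℝ W] [CompleteSpace W]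

/-- Local solutions of a linear differential equation depending on a parameter, jointly
continuous in the parameter and the time. -/
theorem exists_parametric_linear_ode {B : ℝ × ℝ → W →L[ℝ] W} {p₀ : ℝ × ℝ}
    (hB : ContDiffAt ℝ 1 B p₀) {G : ℝ → W} (hG : ∀ᶠ u in 𝓝 p₀.1, ContinuousAt G u) :
    ∃ F : ℝ × ℝ → W, ∃ r > 0, ∀ p ∈ ball p₀ r, ContinuousAt F p ∧ F (p.1, p₀.2) = G p.1 ∧
      HasDerivAt (fun v => F (p.1, v)) (B p (F p)) p.2 := by
  -- The point p joins the state and moves with velocity (0, 1). The equation becomes autonomous and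
  -- the parameter becomes part of the initial value, so continuity of the flow in its initial value
  -- is continuity in the parameter.
  have hf : ContDiffAt ℝ 1 (fun z : (ℝ × ℝ) × W => (((0 : ℝ), (1 : ℝ)), B z.1 z.2))
      (p₀, G p₀.1) :=
    contDiffAt_const.prodMk
      ((ContDiffAt.comp (p₀, G p₀.1) hB contDiffAt_fst).clm_apply contDiffAt_snd)
  obtain ⟨ε, hε, a, r, L, K, hr, hpl⟩ := IsPicardLindelof.of_contDiffAt_one hf
  obtain ⟨α, hα, hαc⟩ :=
    (hpl p₀.2).exists_forall_mem_closedBall_eq_hasDerivWithinAt_continuousOn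
  set I := Icc (p₀.2 - ε) (p₀.2 + ε)
  let z : ℝ → (ℝ × ℝ) × W := fun u => ((u, p₀.2), G u)
  have hzc : ∀ᶠ u in 𝓝 p₀.1, ContinuousAt z u := by
    filter_upwards [hG] with u hu
    exact (continuousAt_id.prodMk continuousAt_const).prodMk hu
  have hz : ∀ᶠ u in 𝓝 p₀.1, z u ∈ ball (p₀, G p₀.1) r :=
    (hzc.self_of_nhds).eventually_mem (ball_mem_nhds _ hr)
  obtain ⟨δ, hδ, hδ'⟩ := Metric.eventually_nhds_iff_ball.1 (hz.and hzc)
  refine ⟨fun p => (α (z p.1, p.2)).2, min δ ε, lt_min hδ hε, fun p hp => ?_⟩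
  have hp1 : p.1 ∈ ball p₀.1 δ :=
    lt_of_le_of_lt (b := dist p p₀) (le_max_left _ _) (lt_of_lt_of_le hp (min_le_left _ _))
  have hp2 : p.2 ∈ ball p₀.2 ε :=
    lt_of_le_of_lt (b := dist p p₀) (le_max_right _ _) (lt_of_lt_of_le hp (min_le_right _ _))
  have hIo : Ioo (p₀.2 - ε) (p₀.2 + ε) = ball p₀.2 ε := (Real.ball_eq_Ioo _ _).symm
  have hp2I : I ∈ 𝓝 p.2 := by
    refine mem_of_superset ?_ (Ioo_subset_Icc_self)
    rw [hIo]; exact isOpen_ball.mem_nhds hp2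
  obtain ⟨hzp, hzcp⟩ := hδ' _ hp1
  obtain ⟨h0, h1⟩ := hα _ (ball_subset_closedBall hzp)
  -- The base point of the flow line really is (u, t): the difference has zero derivative and
  -- vanishes at the initial time. Hence the W-component solves the original equation.
  have hfst : ∀ t ∈ I, (α (z p.1, t)).1 = (p.1, t) := by
    have hd : ∀ t ∈ I, HasDerivWithinAt (fun t => (α (z p.1, t)).1 - (p.1, t)) 0 I t := by
      intro t ht
      have e1 : HasDerivWithinAt (fun t => (α (z p.1, t)).1) ((0 : ℝ), (1 : ℝ)) I t :=
        hasFDerivAt_fst.comp_hasDerivWithinAt (l := fun x : (ℝ × ℝ) × W => x.1)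
          (l' := ContinuousLinearMap.fst ℝ (ℝ × ℝ) W) t (h1 t ht)
      have e2 : HasDerivWithinAt (fun t : ℝ => (p.1, t)) ((0 : ℝ), (1 : ℝ)) I t :=
        (hasDerivWithinAt_const t I p.1).prodMk (hasDerivWithinAt_id t I)
      exact (e1.fun_sub e2).congr_deriv (sub_self _)
    intro t ht
    have hc := (convex_Icc (p₀.2 - ε) (p₀.2 + ε)).norm_image_sub_le_of_norm_hasDerivWithin_le
      (C := 0) hd (by simp) (x := p₀.2) (y := t) ⟨by linarith, by linarith⟩ ht
    have h0' : α (z p.1, p₀.2) = z p.1 := h0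
    rw [h0'] at hc
    simpa [z, sub_eq_zero] using hc
  have hder := h1 p.2 (mem_of_mem_nhds hp2I)
  refine ⟨?_, ?_, ?_⟩
  · refine ContinuousAt.snd (ContinuousAt.comp (g := α) (f := fun p : ℝ × ℝ => (z p.1, p.2)) ?_ ?_)
    · exact hαc.continuousAt (prod_mem_nhds
        (mem_of_superset (isOpen_ball.mem_nhds hzp) ball_subset_closedBall) hp2I)
    · exact ContinuousAt.prodMk (ContinuousAt.comp (g := z) hzcp continuousAt_fst)
        continuousAt_snd
  · have h0' : α (z p.1, p₀.2) = z p.1 := h0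
    simp [h0', z]
  · have := (hasFDerivAt_snd.comp_hasDerivWithinAt p.2 hder).hasDerivAt hp2I
    have e := hfst p.2 (mem_of_mem_nhds hp2I)
    simpa [e, Function.comp_def] using this

end LinearSystem

/-! ### Propagation of the u-equation under the integrability condition. -/

section Compatible

variable {W : Type*} [NormedAddCommGroup W] [NormedSpace ℝ W]

/-- First-order expansion of a `C¹` function in its first variable, uniformly on a compact set
of values of the second one. -/
theorem eventually_forall_norm_sub_sub_le {B : ℝ × ℝ → W} {u : ℝ} {K : Set ℝ}
    (hK : IsCompact K) (hB : ∀ s ∈ K, ContDiffAt ℝ 1 B (u, s)) {ε : ℝ} (hε : 0 < ε) :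
    ∀ᶠ h in 𝓝 (0 : ℝ), ∀ s ∈ K,
      ‖B (u + h, s) - B (u, s) - h • fderiv ℝ B (u, s) (1, 0)‖ ≤ ε * |h| := by
  refine hK.eventually_forall_of_forall_eventually fun s hs => ?_
  -- Strict differentiability lets the base point (u, s') vary near (u, s). It costs ε/2, and
  -- replacing the derivative at (u, s) by that at (u, s') costs the other ε/2.
  have hst := ((hB s hs).hasStrictFDerivAt one_ne_zero).isLittleO.def (half_pos hε)
  have t1 : Tendsto (fun z : ℝ × ℝ => ((u + z.1, z.2), (u, z.2))) (𝓝 (0, s))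
      (𝓝 ((u, s), (u, s))) := by
    have : Continuous (fun z : ℝ × ℝ => ((u + z.1, z.2), (u, z.2))) := by fun_prop
    simpa using this.tendsto (0, s)
  have t2 : Tendsto (fun z : ℝ × ℝ => (u, z.2)) (𝓝 (0, s)) (𝓝 (u, s)) := by
    have : Continuous (fun z : ℝ × ℝ => (u, z.2)) := by fun_prop
    simpa using this.tendsto (0, s)
  have hc : ContinuousAt (fderiv ℝ B) (u, s) :=
    ((hB s hs).fderiv_right (m := 0) (by norm_num)).continuousAt
  have hc' := hc.eventually (Metric.ball_mem_nhds _ (half_pos hε))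
  filter_upwards [t1.eventually hst, t2.eventually hc'] with z h1 h2
  have hn : ‖((z.1, 0) : ℝ × ℝ)‖ = |z.1| := by simp [Prod.norm_def]
  have e1 : ((u + z.1, z.2) : ℝ × ℝ) - (u, z.2) = (z.1, 0) := by simp
  rw [e1, hn] at h1
  have e2 : z.1 • fderiv ℝ B (u, z.2) (1, 0) = fderiv ℝ B (u, z.2) (z.1, 0) := by
    rw [← map_smul]; simp
  have h3 : ‖(fderiv ℝ B (u, z.2) - fderiv ℝ B (u, s)) (z.1, 0)‖ ≤ ε / 2 * |z.1| := by
    refine (ContinuousLinearMap.le_opNorm _ _).trans ?_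
    rw [hn]
    exact mul_le_mul_of_nonneg_right (by rw [← dist_eq_norm]; exact le_of_lt h2) (abs_nonneg _)
  calc _ = ‖(B (u + z.1, z.2) - B (u, z.2) - fderiv ℝ B (u, s) (z.1, 0)) -
        (fderiv ℝ B (u, z.2) - fderiv ℝ B (u, s)) (z.1, 0)‖ := by
        rw [e2, _root_.sub_apply]; congr 1; abel
    _ ≤ ε / 2 * |z.1| + ε / 2 * |z.1| := (norm_sub_le _ _).trans (add_le_add h1 h3)
    _ = ε * |z.1| := by ring

/-- A solution of `F_v = B F` which satisfies `F_u = A F` on the line `v = v₀` satisfies it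
everywhere, when the integrability condition `A_v + A B = B_u + B A` holds. -/
theorem hasDerivAt_fst_of_compatible {A B : ℝ × ℝ → W →L[ℝ] W} {p₀ : ℝ × ℝ} {r : ℝ}
    (hA : ∀ p ∈ ball p₀ r, ContDiffAt ℝ 1 A p) (hB : ∀ p ∈ ball p₀ r, ContDiffAt ℝ 1 B p)
    (hcomp : ∀ p ∈ ball p₀ r, ∀ w,
      fderiv ℝ A p (0, 1) w + A p (B p w) = fderiv ℝ B p (1, 0) w + B p (A p w))
    {F : ℝ × ℝ → W} (hFc : ∀ p ∈ ball p₀ r, ContinuousAt F p)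
    (hFv : ∀ p ∈ ball p₀ r, HasDerivAt (fun v => F (p.1, v)) (B p (F p)) p.2)
    (hF0 : ∀ u ∈ ball p₀.1 r,
      HasDerivAt (fun u => F (u, p₀.2)) (A (u, p₀.2) (F (u, p₀.2))) u)
    {p : ℝ × ℝ} (hp : p ∈ ball p₀ r) :
    HasDerivAt (fun u => F (u, p.2)) (A p (F p)) p.1 := by
  obtain ⟨u₀, v₀⟩ := p₀
  obtain ⟨u, v⟩ := p
  have hmem : ∀ a b : ℝ, (a, b) ∈ ball (u₀, v₀) r ↔ a ∈ ball u₀ r ∧ b ∈ ball v₀ r := by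
    intro a b; rw [← ball_prod_same]; rfl
  obtain ⟨hu, hv⟩ := (hmem u v).1 hp
  have hr : 0 < r := dist_nonneg.trans_lt hv
  set c := v - v₀ with hc
  -- The segment from v₀ to v is run over [0, 1], so that one forward Gronwall estimate covers both
  -- v ≥ v₀ and v < v₀.
  set γ : ℝ → ℝ := fun t => v₀ + t * c with hγ
  have hγd : ∀ t, HasDerivAt γ c t := fun t => by
    simpa [hγ] using! ((hasDerivAt_id t).mul_const c).const_add v₀
  have hγc : Continuous γ := by fun_prop
  have hγm : ∀ t ∈ Icc (0 : ℝ) 1, γ t ∈ ball v₀ r := by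
    intro t ht
    rw [mem_ball, Real.dist_eq] at hv ⊢
    have : γ t - v₀ = t * c := by simp [hγ]
    rw [this, abs_mul, abs_of_nonneg ht.1]
    exact (mul_le_of_le_one_left (abs_nonneg _) ht.2).trans_lt hv
  set K := γ '' Icc 0 1 with hK
  have hKc : IsCompact K := isCompact_Icc.image hγc
  have hKm : ∀ s ∈ K, (u, s) ∈ ball (u₀, v₀) r := by
    rintro _ ⟨t, ht, rfl⟩; exact (hmem _ _).2 ⟨hu, hγm t ht⟩
  have hι : ∀ s, ContinuousAt (fun s : ℝ => (u, s)) s := fun s => by fun_prop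
  have cB : ContinuousOn (fun s => B (u, s)) K := fun s hs =>
    ((hB _ (hKm s hs)).continuousAt.comp (hι s)).continuousWithinAt
  have cA : ContinuousOn (fun s => A (u, s)) K := fun s hs =>
    ((hA _ (hKm s hs)).continuousAt.comp (hι s)).continuousWithinAt
  have cF : ContinuousOn (fun s => F (u, s)) K := fun s hs =>
    ((hFc _ (hKm s hs)).comp (hι s)).continuousWithinAt
  have cBu : ContinuousOn (fun s => fderiv ℝ B (u, s) (1, 0)) K := fun s hs =>
    ((((hB _ (hKm s hs)).fderiv_right (m := 0) (by norm_num)).continuousAt.comp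
      (hι s)).clm_apply continuousAt_const).continuousWithinAt
  obtain ⟨b₁, hb₁⟩ := hKc.exists_bound_of_continuousOn cB
  obtain ⟨b₂, hb₂⟩ := hKc.exists_bound_of_continuousOn cBu
  obtain ⟨b₃, hb₃⟩ := hKc.exists_bound_of_continuousOn cF
  obtain ⟨b₄, hb₄⟩ := hKc.exists_bound_of_continuousOn (cA.clm_apply cF)
  have h0K : γ 0 ∈ K := ⟨0, by simp, rfl⟩
  have hb₁0 := (norm_nonneg _).trans (hb₁ _ h0K)
  have hb₂0 := (norm_nonneg _).trans (hb₂ _ h0K)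
  have hb₃0 := (norm_nonneg _).trans (hb₃ _ h0K)
  have hb₄0 := (norm_nonneg _).trans (hb₄ _ h0K)
  -- The factor b₁ + (1 + b₂) bounds B(u + h, ·) for |h| ≤ 1. The added 1 keeps κ positive, so that
  -- the closed formula for `gronwallBound` applies.
  set κ := |c| * (b₁ + (1 + b₂)) + 1 with hκ
  have hκ0 : 0 < κ := by positivity
  set C := |c| * (b₃ + (1 + b₂) * b₄) with hC
  have hC0 : 0 ≤ C := by positivity
  -- The Gronwall bound is linear in the initial error and the forcing term, so errors η|h| and
  -- Cη|h| give η|h|Q; this dictates η = ε/(Q + 1) below.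
  set Q := gronwallBound 1 κ C 1 with hQ
  have hQ0 : 0 ≤ Q := by
    rw [hQ, gronwallBound_of_K_ne_0 hκ0.ne']
    have : 1 ≤ Real.exp (κ * 1) := Real.one_le_exp (by positivity)
    have : 0 ≤ C / κ * (Real.exp (κ * 1) - 1) := mul_nonneg (by positivity) (by linarith)
    have := Real.exp_pos (κ * 1)
    simp only; linarith
  rw [hasDerivAt_iff_isLittleO_nhds_zero, Asymptotics.isLittleO_iff]
  intro ε hε
  set η := ε / (Q + 1) with hη
  have hη0 : 0 < η := by positivity
  have hBs : ∀ s ∈ K, ContDiffAt ℝ 1 B (u, s) := fun s hs => hB _ (hKm s hs)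
  have ev0 := (hasDerivAt_iff_isLittleO_nhds_zero.1 (hF0 u hu)).def hη0
  have ev1 := eventually_forall_norm_sub_sub_le hKc hBs hη0
  have ev2 := eventually_forall_norm_sub_sub_le hKc hBs one_pos
  have ev3 : ∀ᶠ h in 𝓝 (0 : ℝ), u + h ∈ ball u₀ r := by
    have : Tendsto (fun h => u + h) (𝓝 0) (𝓝 u) := by
      simpa using! (continuous_const.add continuous_id : Continuous fun h : ℝ => u + h).tendsto 0
    exact this.eventually (isOpen_ball.mem_nhds hu)
  have ev4 : ∀ᶠ h in 𝓝 (0 : ℝ), |h| < min 1 η := by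
    filter_upwards [Metric.ball_mem_nhds (0 : ℝ) (lt_min one_pos hη0)] with h hh
    simpa only [mem_ball, dist_zero_right, Real.norm_eq_abs] using hh
  filter_upwards [ev0, ev1, ev2, ev3, ev4] with h h0 h1 h2 h3 h4
  have h41 : |h| ≤ 1 := (h4.trans_le (min_le_left _ _)).le
  have h4η : |h| ≤ η := (h4.trans_le (min_le_right _ _)).le
  -- This remainder must be shown to be o(h). It is used because F is not yet known to be
  -- differentiable in u. Integrability replaces A_v + AB in its v-derivative by B_u + BA, leaving a
  -- linear equation in ψ with small forcing.
  set ψ : ℝ → W := fun s => F (u + h, s) - F (u, s) - h • A (u, s) (F (u, s)) with hψ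
  have hψd : ∀ s, s ∈ K → HasDerivAt ψ (B (u + h, s) (ψ s) +
      (B (u + h, s) - B (u, s) - h • fderiv ℝ B (u, s) (1, 0)) (F (u, s)) +
      h • (B (u + h, s) - B (u, s)) (A (u, s) (F (u, s)))) s := by
    intro s hs
    have m := hKm s hs
    have m' : (u + h, s) ∈ ball (u₀, v₀) r := (hmem _ _).2 ⟨h3, ((hmem _ _).1 m).2⟩
    have dA : HasDerivAt (fun s => A (u, s)) (fderiv ℝ A (u, s) (0, 1)) s :=
      ((hA _ m).differentiableAt one_ne_zero).hasFDerivAt.comp_hasDerivAt s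
        ((hasDerivAt_const s u).prodMk (hasDerivAt_id s))
    have dF : HasDerivAt (fun s => F (u, s)) (B (u, s) (F (u, s))) s := hFv _ m
    have dF' : HasDerivAt (fun s => F (u + h, s)) (B (u + h, s) (F (u + h, s))) s := hFv _ m'
    have d : HasDerivAt ψ _ s := (dF'.sub dF).sub ((dA.clm_apply dF).const_smul h)
    refine d.congr_deriv ?_
    have := hcomp _ m (F (u, s))
    simp only [hψ, this]
    simp only [map_sub, map_smul, _root_.sub_apply, _root_.smul_apply,
      smul_add, smul_sub]
    abel
  have hφd : ∀ t ∈ Icc (0 : ℝ) 1, HasDerivAt (ψ ∘ γ) _ t := fun t ht =>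
    (hψd (γ t) ⟨t, ht, rfl⟩).scomp t (hγd t)
  have key := norm_le_gronwallBound_of_norm_deriv_right_le (f := ψ ∘ γ) (δ := η * |h|) (K := κ)
    (ε := C * (η * |h|)) (a := 0) (b := 1) (fun t ht => (hφd t ht).continuousAt.continuousWithinAt)
    (fun t ht => (hφd t (Ico_subset_Icc_self ht)).hasDerivWithinAt) ?_ ?_ 1 (by simp)
  · have e1 : (ψ ∘ γ) 1 = F (u + h, v) - F (u, v) - h • A (u, v) (F (u, v)) := by
      simp [hψ, hγ, hc]
    rw [e1] at key
    refine key.trans ?_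
    have : gronwallBound (η * |h|) κ (C * (η * |h|)) (1 - 0) = η * |h| * Q := by
      rw [hQ, gronwallBound_of_K_ne_0 hκ0.ne', gronwallBound_of_K_ne_0 hκ0.ne']
      simp only [sub_zero]; ring
    rw [this, Real.norm_eq_abs, hη]
    have : ε / (Q + 1) * |h| * Q = (ε * |h|) * (Q / (Q + 1)) := by ring
    rw [this]
    exact mul_le_of_le_one_right (by positivity) ((div_le_one (by positivity)).2 (by linarith))
  · have e0 : (ψ ∘ γ) 0 = F (u + h, v₀) - F (u, v₀) - h • A (u, v₀) (F (u, v₀)) := by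
      simp [hψ, hγ]
    rw [e0]
    simpa using h0
  · intro t ht
    have hs : γ t ∈ K := ⟨t, Ico_subset_Icc_self ht, rfl⟩
    set s := γ t with hst
    have hBd : ‖B (u + h, s) - B (u, s)‖ ≤ (1 + b₂) * |h| := by
      have e : B (u + h, s) - B (u, s) =
        (B (u + h, s) - B (u, s) - h • fderiv ℝ B (u, s) (1, 0)) +
          h • fderiv ℝ B (u, s) (1, 0) := by abel
      rw [e]
      refine (norm_add_le _ _).trans ?_
      rw [norm_smul, Real.norm_eq_abs]
      have := mul_le_mul_of_nonneg_left (hb₂ s hs) (abs_nonneg h)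
      have := h2 s hs
      linarith
    have hBn : ‖B (u + h, s)‖ ≤ b₁ + (1 + b₂) := by
      have e : B (u + h, s) = B (u, s) + (B (u + h, s) - B (u, s)) := by abel
      rw [e]
      refine (norm_add_le _ _).trans (add_le_add (hb₁ s hs) (hBd.trans ?_))
      exact mul_le_of_le_one_right (by positivity) h41
    have n1 : ‖B (u + h, s) (ψ s)‖ ≤ (b₁ + (1 + b₂)) * ‖ψ s‖ :=
      ContinuousLinearMap.le_of_opNorm_le _ hBn _
    have n2 : ‖(B (u + h, s) - B (u, s) - h • fderiv ℝ B (u, s) (1, 0)) (F (u, s))‖ ≤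
        η * |h| * b₃ :=
      (ContinuousLinearMap.le_of_opNorm_le _ (h1 s hs) _).trans
        (mul_le_mul_of_nonneg_left (hb₃ s hs) (by positivity))
    -- This term is quadratic in h; |h| ≤ η turns it into a multiple of η|h|.
    have n3 : ‖h • (B (u + h, s) - B (u, s)) (A (u, s) (F (u, s)))‖ ≤
        η * |h| * ((1 + b₂) * b₄) := by
      rw [norm_smul, Real.norm_eq_abs]
      have := (ContinuousLinearMap.le_of_opNorm_le _ hBd (A (u, s) (F (u, s)))).trans
        (mul_le_mul_of_nonneg_left (hb₄ s hs) (by positivity))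
      calc _ ≤ |h| * ((1 + b₂) * |h| * b₄) := mul_le_mul_of_nonneg_left this (abs_nonneg _)
        _ = |h| * (|h| * ((1 + b₂) * b₄)) := by ring
        _ ≤ η * (|h| * ((1 + b₂) * b₄)) := mul_le_mul_of_nonneg_right h4η (by positivity)
        _ = _ := by ring
    rw [norm_smul, Real.norm_eq_abs]
    have n : ‖B (u + h, s) (ψ s) +
        (B (u + h, s) - B (u, s) - h • fderiv ℝ B (u, s) (1, 0)) (F (u, s)) +
        h • (B (u + h, s) - B (u, s)) (A (u, s) (F (u, s)))‖ ≤
        (b₁ + (1 + b₂)) * ‖ψ s‖ + η * |h| * b₃ + η * |h| * ((1 + b₂) * b₄) :=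
      (norm_add₃_le).trans (add_le_add (add_le_add n1 n2) n3)
    refine (mul_le_mul_of_nonneg_left n (abs_nonneg c)).trans ?_
    have : (ψ ∘ γ) t = ψ s := rfl
    rw [this, hκ, hC]
    have := norm_nonneg (ψ s)
    nlinarith

end Compatible

/-! ### Local solvability of completely integrable linear systems. -/

section Existence

variable {W : Type*} [NormedAddCommGroup W] [NormedSpace ℝ W] [CompleteSpace W]

/-- Local existence for a completely integrable linear system `F_u = A F`, `F_v = B F`. -/
theorem exists_solution_of_compatible {A B : ℝ × ℝ → W →L[ℝ] W} {D : Set (ℝ × ℝ)}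
    (hD : IsOpen D) (hA : ContDiffOn ℝ 1 A D) (hB : ContDiffOn ℝ 1 B D)
    (hcomp : ∀ p ∈ D, ∀ w,
      fderiv ℝ A p (0, 1) w + A p (B p w) = fderiv ℝ B p (1, 0) w + B p (A p w))
    {p₀ : ℝ × ℝ} (hp₀ : p₀ ∈ D) (w₀ : W) :
    ∃ r > 0, ball p₀ r ⊆ D ∧ ∃ F : ℝ × ℝ → W, F p₀ = w₀ ∧ ∀ p ∈ ball p₀ r,
      DifferentiableAt ℝ F p ∧ du F p = A p (F p) ∧ dv F p = B p (F p) := by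
  have hAt : ∀ p ∈ D, ContDiffAt ℝ 1 A p := fun p hp => hA.contDiffAt (hD.mem_nhds hp)
  have hBt : ∀ p ∈ D, ContDiffAt ℝ 1 B p := fun p hp => hB.contDiffAt (hD.mem_nhds hp)
  -- Interchanging the coordinates lets the same parametric lemma solve the u-equation along v = v₀.
  -- Its solution is the initial value for the v-equation.
  have hAs : ContDiffAt ℝ 1 (fun q : ℝ × ℝ => A q.swap) p₀.swap :=
    ContDiffAt.comp p₀.swap (g := A) (f := Prod.swap) (hAt p₀ hp₀)
      (contDiff_snd.prodMk contDiff_fst).contDiffAt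
  obtain ⟨G, r₁, hr₁, hG⟩ := exists_parametric_linear_ode hAs (G := fun _ => w₀)
    (Eventually.of_forall fun _ => continuousAt_const)
  have hGd : ∀ u ∈ ball p₀.1 r₁, HasDerivAt (fun u => G (p₀.2, u))
      (A (u, p₀.2) (G (p₀.2, u))) u := by
    intro u hu
    exact (hG (p₀.2, u) (by
      rw [← ball_prod_same]; exact ⟨mem_ball_self hr₁, hu⟩)).2.2
  obtain ⟨F, r₂, hr₂, hF⟩ := exists_parametric_linear_ode (hBt p₀ hp₀)
    (G := fun u => G (p₀.2, u))
    (mem_of_superset (ball_mem_nhds _ hr₁) fun u hu => (hGd u hu).continuousAt)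
  obtain ⟨r₃, hr₃, hrD⟩ := Metric.isOpen_iff.1 hD p₀ hp₀
  set r := min r₁ (min r₂ r₃)
  have hr : 0 < r := lt_min hr₁ (lt_min hr₂ hr₃)
  have s1 : r ≤ r₁ := min_le_left _ _
  have s2 : ball p₀ r ⊆ ball p₀ r₂ :=
    ball_subset_ball ((min_le_right _ _).trans (min_le_left _ _))
  have s3 : ball p₀ r ⊆ D :=
    (ball_subset_ball ((min_le_right _ _).trans (min_le_right _ _))).trans hrD
  have hF0 : ∀ u ∈ ball p₀.1 r, F (u, p₀.2) = G (p₀.2, u) := fun u hu =>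
    (hF (u, p₀.2) (s2 (by rw [← ball_prod_same]; exact ⟨hu, mem_ball_self hr⟩))).2.1
  have hFu : ∀ p ∈ ball p₀ r, HasDerivAt (fun u => F (u, p.2)) (A p (F p)) p.1 := by
    intro p hp
    refine hasDerivAt_fst_of_compatible (fun p hp => hAt p (s3 hp)) (fun p hp => hBt p (s3 hp))
      (fun p hp => hcomp p (s3 hp)) (fun p hp => (hF p (s2 hp)).1)
      (fun p hp => (hF p (s2 hp)).2.2) (fun u hu => ?_) hp
    rw [hF0 u hu]
    refine (hGd u (ball_subset_ball s1 hu)).congr_of_eventuallyEq ?_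
    filter_upwards [isOpen_ball.mem_nhds hu] with u' hu' using hF0 u' hu'
  refine ⟨r, hr, s3, F, ?_, fun p hp => ?_⟩
  · have e1 := hF0 p₀.1 (mem_ball_self hr)
    have e2 := (hG p₀.swap (mem_ball_self hr₁)).2.1
    exact e1.trans e2
  · have hnear : ∀ᶠ q in 𝓝 p, q ∈ ball p₀ r := isOpen_ball.mem_nhds hp
    have cF := (hF p (s2 hp)).1
    have cL : Continuous fun w : W => ContinuousLinearMap.toSpanSingleton ℝ w :=
      (ContinuousLinearMap.toSpanSingletonCLE (𝕜 := ℝ) (E := W)).continuous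
    -- Both partial derivatives exist nearby and are continuous at p, being A F and B F, so F is
    -- differentiable.
    have hs := hasStrictFDerivAt_uncurry_coprod (𝕜 := ℝ) (u := p) (f := fun a b => F (a, b))
      (f₁ := fun a b => ContinuousLinearMap.toSpanSingleton ℝ (A (a, b) (F (a, b))))
      (f₂ := fun a b => ContinuousLinearMap.toSpanSingleton ℝ (B (a, b) (F (a, b))))
      (by filter_upwards [hnear] with q hq using (hFu q hq).hasFDerivAt)
      (by filter_upwards [hnear] with q hq using (hF q (s2 hq)).2.2.hasFDerivAt)
      (cL.continuousAt.comp ((hAt p (s3 hp)).continuousAt.clm_apply cF))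
      (cL.continuousAt.comp ((hBt p (s3 hp)).continuousAt.clm_apply cF))
    have hd : HasFDerivAt F _ p := hs.hasFDerivAt
    refine ⟨hd.differentiableAt, ?_, ?_⟩
    · rw [du, hd.fderiv]; simp [Function.HasUncurry.uncurry]
    · rw [dv, hd.fderiv]; simp [Function.HasUncurry.uncurry]

end Existence

/-! ### Calculus of the two partial derivatives. -/

section Partial

variable {V : Type*} [NormedAddCommGroup V] [NormedSpace ℝ V] {f g : ℝ × ℝ → V} {a : ℝ × ℝ → ℝ}
  {p : ℝ × ℝ} {S : Set (ℝ × ℝ)}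

theorem du_congr (hS : IsOpen S) (hp : p ∈ S) (h : EqOn f g S) : du f p = du g p := by
  rw [du, du, (h.eventuallyEq_of_mem (hS.mem_nhds hp)).fderiv_eq]

theorem dv_congr (hS : IsOpen S) (hp : p ∈ S) (h : EqOn f g S) : dv f p = dv g p := by
  rw [dv, dv, (h.eventuallyEq_of_mem (hS.mem_nhds hp)).fderiv_eq]

theorem du_const (c : V) : du (fun _ => c) p = 0 := by simp [du]

theorem dv_const (c : V) : dv (fun _ => c) p = 0 := by simp [dv]

theorem du_sub (hf : DifferentiableAt ℝ f p) (hg : DifferentiableAt ℝ g p) :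
    du (fun q => f q - g q) p = du f p - du g p := by
  simp [du, fderiv_fun_sub hf hg]

theorem dv_sub (hf : DifferentiableAt ℝ f p) (hg : DifferentiableAt ℝ g p) :
    dv (fun q => f q - g q) p = dv f p - dv g p := by
  simp [dv, fderiv_fun_sub hf hg]

theorem du_smul (ha : DifferentiableAt ℝ a p) (hf : DifferentiableAt ℝ f p) :
    du (fun q => a q • f q) p = a p • du f p + du a p • f p := by
  simp [du, fderiv_fun_smul ha hf]

theorem dv_smul (ha : DifferentiableAt ℝ a p) (hf : DifferentiableAt ℝ f p) :
    dv (fun q => a q • f q) p = a p • dv f p + dv a p • f p := by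
  simp [dv, fderiv_fun_smul ha hf]

theorem du_comp {φ : ℝ → ℝ} {φ' : ℝ} (hφ : HasDerivAt φ φ' (a p)) (ha : DifferentiableAt ℝ a p) :
    du (fun q => φ (a q)) p = φ' * du a p := by
  have : HasFDerivAt (fun q => φ (a q)) _ p := hφ.comp_hasFDerivAt p ha.hasFDerivAt
  simp [du, this.fderiv]

theorem dv_comp {φ : ℝ → ℝ} {φ' : ℝ} (hφ : HasDerivAt φ φ' (a p)) (ha : DifferentiableAt ℝ a p) :
    dv (fun q => φ (a q)) p = φ' * dv a p := by
  have : HasFDerivAt (fun q => φ (a q)) _ p := hφ.comp_hasFDerivAt p ha.hasFDerivAt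
  simp [dv, this.fderiv]

theorem du_clm {V' : Type*} [NormedAddCommGroup V'] [NormedSpace ℝ V'] (T : V →L[ℝ] V')
    (hf : DifferentiableAt ℝ f p) : du (fun q => T (f q)) p = T (du f p) := by
  have : HasFDerivAt (fun q => T (f q)) _ p := T.hasFDerivAt.comp p hf.hasFDerivAt
  simp [du, this.fderiv]

theorem dv_clm {V' : Type*} [NormedAddCommGroup V'] [NormedSpace ℝ V'] (T : V →L[ℝ] V')
    (hf : DifferentiableAt ℝ f p) : dv (fun q => T (f q)) p = T (dv f p) := by
  have : HasFDerivAt (fun q => T (f q)) _ p := T.hasFDerivAt.comp p hf.hasFDerivAt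
  simp [dv, this.fderiv]

theorem du_inner {f g : ℝ × ℝ → E3} (hf : DifferentiableAt ℝ f p) (hg : DifferentiableAt ℝ g p) :
    du (fun q => ⟪f q, g q⟫) p = ⟪f p, du g p⟫ + ⟪du f p, g p⟫ :=
  fderiv_inner_apply ℝ hf hg _

theorem dv_inner {f g : ℝ × ℝ → E3} (hf : DifferentiableAt ℝ f p) (hg : DifferentiableAt ℝ g p) :
    dv (fun q => ⟪f q, g q⟫) p = ⟪f p, dv g p⟫ + ⟪dv f p, g p⟫ :=
  fderiv_inner_apply ℝ hf hg _

theorem contDiffOn_du {k m : WithTop ℕ∞} (hS : IsOpen S) (hf : ContDiffOn ℝ k f S)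
    (h : m + 1 ≤ k) : ContDiffOn ℝ m (du f) S :=
  (hf.fderiv_of_isOpen hS h).clm_apply contDiffOn_const

theorem contDiffOn_dv {k m : WithTop ℕ∞} (hS : IsOpen S) (hf : ContDiffOn ℝ k f S)
    (h : m + 1 ≤ k) : ContDiffOn ℝ m (dv f) S :=
  (hf.fderiv_of_isOpen hS h).clm_apply contDiffOn_const

theorem du_dv_comm (h : ContDiffAt ℝ 2 f p) : du (dv f) p = dv (du f) p := by
  have hd : DifferentiableAt ℝ (fderiv ℝ f) p :=
    (h.fderiv_right (m := 1) (by norm_num)).differentiableAt one_ne_zero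
  have hs := h.isSymmSndFDerivAt (by simp)
  have e : ∀ c d : ℝ × ℝ, fderiv ℝ (fun q => fderiv ℝ f q c) p d =
      fderiv ℝ (fderiv ℝ f) p d c := fun c d => by
    simp [fderiv_clm_apply hd (differentiableAt_const c)]
  unfold du dv
  rw [e, e]
  exact hs _ _

/-- A function whose two partial derivatives are of class `C^k` is of class `C^(k+1)`. -/
theorem contDiffOn_succ_of_partials {k : ℕ} (hS : IsOpen S)
    (hf : ∀ p ∈ S, DifferentiableAt ℝ f p) (hu : ContDiffOn ℝ k (du f) S)
    (hv : ContDiffOn ℝ k (dv f) S) : ContDiffOn ℝ (k + 1 : ℕ) f S := by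
  have e : fderiv ℝ f = fun p => (ContinuousLinearMap.smulRightL ℝ (ℝ × ℝ) V
      (ContinuousLinearMap.fst ℝ ℝ ℝ)) (du f p) + (ContinuousLinearMap.smulRightL ℝ (ℝ × ℝ) V
      (ContinuousLinearMap.snd ℝ ℝ ℝ)) (dv f p) := by
    funext p
    ext <;> simp [du, dv]
  push_cast
  rw [contDiffOn_succ_iff_fderiv_of_isOpen hS]
  refine ⟨fun p hp => (hf p hp).differentiableWithinAt, by simp, ?_⟩
  rw [e]
  exact ((ContinuousLinearMap.contDiff _).comp_contDiffOn hu).add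
    ((ContinuousLinearMap.contDiff _).comp_contDiffOn hv)

theorem eq_of_partials_eq_zero (hS : IsOpen S) (hc : IsPreconnected S)
    (hf : ∀ p ∈ S, DifferentiableAt ℝ f p) (hu : ∀ p ∈ S, du f p = 0) (hv : ∀ p ∈ S, dv f p = 0)
    {q : ℝ × ℝ} (hp : p ∈ S) (hq : q ∈ S) : f p = f q := by
  refine hS.is_const_of_fderiv_eq_zero (𝕜 := ℝ) hc (fun p hp => (hf p hp).differentiableWithinAt)
    (fun p hp => ?_) hp hq
  ext
  · simpa [du] using hu p hp
  · simpa [dv] using hv p hp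

/-- Solutions of a linear system with coefficients of class `C^k` are of class `C^(k+1)`. -/
theorem contDiffOn_of_linear_system {A B : ℝ × ℝ → V →L[ℝ] V} (hS : IsOpen S)
    (hf : ∀ p ∈ S, DifferentiableAt ℝ f p ∧ du f p = A p (f p) ∧ dv f p = B p (f p)) {k : ℕ}
    (hA : ContDiffOn ℝ k A S) (hB : ContDiffOn ℝ k B S) : ContDiffOn ℝ (k + 1 : ℕ) f S := by
  -- Bootstrapping: if f is C^k then so are A f and B f, its partial derivatives, and f is C^(k+1).
  induction k with
  | zero =>
    have hfc : ContDiffOn ℝ (0 : ℕ) f S :=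
      contDiffOn_zero.2 fun p hp => (hf p hp).1.continuousAt.continuousWithinAt
    exact contDiffOn_succ_of_partials hS (fun p hp => (hf p hp).1)
      ((hA.clm_apply hfc).congr fun p hp => (hf p hp).2.1)
      ((hB.clm_apply hfc).congr fun p hp => (hf p hp).2.2)
  | succ k ih =>
    have hle : ((k : ℕ) : WithTop ℕ∞) ≤ ((k + 1 : ℕ) : WithTop ℕ∞) := by
      exact_mod_cast Nat.le_succ k
    have hfc := ih (hA.of_le hle) (hB.of_le hle)
    exact contDiffOn_succ_of_partials hS (fun p hp => (hf p hp).1)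
      ((hA.clm_apply hfc).congr fun p hp => (hf p hp).2.1)
      ((hB.clm_apply hfc).congr fun p hp => (hf p hp).2.2)

end Partial

/-! ### The vector product. -/

section Cross

theorem inner_eq_sum (a b : E3) : ⟪a, b⟫ = a 0 * b 0 + a 1 * b 1 + a 2 * b 2 := by
  simp [PiLp.inner_apply, Fin.sum_univ_three, mul_comm]

theorem cross_apply_zero (a b : E3) : cross a b 0 = a 1 * b 2 - a 2 * b 1 := by
  simp [cross, cross_apply]

theorem cross_apply_one (a b : E3) : cross a b 1 = a 2 * b 0 - a 0 * b 2 := by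
  simp [cross, cross_apply]

theorem cross_apply_two (a b : E3) : cross a b 2 = a 0 * b 1 - a 1 * b 0 := by
  simp [cross, cross_apply]

theorem cross_smul_smul (r s : ℝ) (a b : E3) : cross (r • a) (s • b) = (r * s) • cross a b := by
  ext i
  fin_cases i <;> simp [cross_apply_zero, cross_apply_one, cross_apply_two] <;> ring

/-- Lagrange's identity. -/
theorem inner_cross_cross (a b : E3) :
    ⟪cross a b, cross a b⟫ = ⟪a, a⟫ * ⟪b, b⟫ - ⟪a, b⟫ ^ 2 := by
  simp only [inner_eq_sum, cross_apply_zero, cross_apply_one, cross_apply_two]; ring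

theorem inner_cross_left (a b : E3) : ⟪cross a b, a⟫ = 0 := by
  simp only [inner_eq_sum, cross_apply_zero, cross_apply_one, cross_apply_two]; ring

theorem inner_cross_right (a b : E3) : ⟪cross a b, b⟫ = 0 := by
  simp only [inner_eq_sum, cross_apply_zero, cross_apply_one, cross_apply_two]; ring

/-- Equality in Cauchy–Schwarz for two unit vectors: ‖l - X × Y‖² = 1 - 2 + 1 = 0. -/
theorem eq_cross_of_inner_eq_one {X Y l : E3} (hX : ⟪X, X⟫ = 1) (hY : ⟪Y, Y⟫ = 1)
    (hl : ⟪l, l⟫ = 1) (hXY : ⟪X, Y⟫ = 0) (h : ⟪cross X Y, l⟫ = 1) : l = cross X Y := by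
  have h1 := inner_cross_cross X Y
  rw [hX, hY, hXY] at h1
  have : ⟪l - cross X Y, l - cross X Y⟫ = 0 := by
    rw [inner_sub_left, inner_sub_right, inner_sub_right, real_inner_comm, h, hl, h1,
      real_inner_comm, h]; norm_num
  exact sub_eq_zero.1 (inner_self_eq_zero.1 this)

/-- The vector product as a continuous bilinear map. -/
noncomputable def crossL : E3 →L[ℝ] E3 →L[ℝ] E3 :=
  LinearMap.mkContinuous₂ (LinearMap.mk₂ ℝ cross
    (fun a b c => by
      ext i; fin_cases i <;> simp [cross_apply_zero, cross_apply_one, cross_apply_two] <;> ring)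
    (fun r a b => by
      ext i; fin_cases i <;> simp [cross_apply_zero, cross_apply_one, cross_apply_two] <;> ring)
    (fun a b c => by
      ext i; fin_cases i <;> simp [cross_apply_zero, cross_apply_one, cross_apply_two] <;> ring)
    (fun r a b => by
      ext i; fin_cases i <;> simp [cross_apply_zero, cross_apply_one, cross_apply_two] <;> ring))
    1 (fun a b => by
      have h := inner_cross_cross a b
      simp only [real_inner_self_eq_norm_sq] at h
      simp only [LinearMap.mk₂_apply, one_mul]
      refine abs_le_of_sq_le_sq' ?_ (by positivity) |>.2
      rw [mul_pow]; nlinarith [sq_nonneg ⟪a, b⟫])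

theorem crossL_apply (a b : E3) : crossL a b = cross a b := rfl

variable {f g : ℝ × ℝ → E3} {p : ℝ × ℝ}

theorem differentiableAt_cross (hf : DifferentiableAt ℝ f p) (hg : DifferentiableAt ℝ g p) :
    DifferentiableAt ℝ (fun q => cross (f q) (g q)) p :=
  (crossL.hasFDerivAt_of_bilinear hf.hasFDerivAt hg.hasFDerivAt).differentiableAt

theorem du_cross (hf : DifferentiableAt ℝ f p) (hg : DifferentiableAt ℝ g p) :
    du (fun q => cross (f q) (g q)) p = cross (f p) (du g p) + cross (du f p) (g p) := by
  have : HasFDerivAt (fun q => cross (f q) (g q)) _ p :=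
    crossL.hasFDerivAt_of_bilinear hf.hasFDerivAt hg.hasFDerivAt
  simp [du, this.fderiv, crossL_apply]

theorem dv_cross (hf : DifferentiableAt ℝ f p) (hg : DifferentiableAt ℝ g p) :
    dv (fun q => cross (f q) (g q)) p = cross (f p) (dv g p) + cross (dv f p) (g p) := by
  have : HasFDerivAt (fun q => cross (f q) (g q)) _ p :=
    crossL.hasFDerivAt_of_bilinear hf.hasFDerivAt hg.hasFDerivAt
  simp [dv, this.fderiv, crossL_apply]

end Cross

/-! ### Moving frames: orthonormality and uniqueness. -/

section MovingFrame

/-- The Gauss and Weingarten equations of the principal frame `X, Y, l` attached to `lam`. -/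
structure IsMovingFrame (lam : ℝ × ℝ → ℝ) (X Y l : ℝ × ℝ → E3) (D : Set (ℝ × ℝ)) : Prop where
  differentiable_X : ∀ p ∈ D, DifferentiableAt ℝ X p
  differentiable_Y : ∀ p ∈ D, DifferentiableAt ℝ Y p
  differentiable_l : ∀ p ∈ D, DifferentiableAt ℝ l p
  du_X : ∀ p ∈ D, du X p = (dv lam p / 2) • Y p + Real.sin (lam p / 2) • l p
  dv_X : ∀ p ∈ D, dv X p = (du lam p / 2) • Y p
  du_Y : ∀ p ∈ D, du Y p = -(dv lam p / 2) • X p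
  dv_Y : ∀ p ∈ D, dv Y p = -(du lam p / 2) • X p - Real.cos (lam p / 2) • l p
  du_l : ∀ p ∈ D, du l p = -Real.sin (lam p / 2) • X p
  dv_l : ∀ p ∈ D, dv l p = Real.cos (lam p / 2) • Y p

/-- `X, Y, l` is an orthonormal basis with `l` the vector product of `X` and `Y`. -/
structure IsOrientedFrame (X Y l : E3) : Prop where
  inner_X : ⟪X, X⟫ = 1
  inner_Y : ⟪Y, Y⟫ = 1
  inner_XY : ⟪X, Y⟫ = 0
  eq_cross : l = cross X Y

namespace IsOrientedFrame

variable {X Y l : E3}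

theorem inner_l (h : IsOrientedFrame X Y l) : ⟪l, l⟫ = 1 := by
  rw [h.eq_cross, inner_cross_cross, h.inner_X, h.inner_Y, h.inner_XY]; norm_num

theorem inner_Xl (h : IsOrientedFrame X Y l) : ⟪X, l⟫ = 0 := by
  rw [h.eq_cross, real_inner_comm, inner_cross_left]

theorem inner_Yl (h : IsOrientedFrame X Y l) : ⟪Y, l⟫ = 0 := by
  rw [h.eq_cross, real_inner_comm, inner_cross_right]

theorem inner_YX (h : IsOrientedFrame X Y l) : ⟪Y, X⟫ = 0 := by rw [real_inner_comm, h.inner_XY]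

theorem inner_lX (h : IsOrientedFrame X Y l) : ⟪l, X⟫ = 0 := by rw [real_inner_comm, h.inner_Xl]

theorem inner_lY (h : IsOrientedFrame X Y l) : ⟪l, Y⟫ = 0 := by rw [real_inner_comm, h.inner_Yl]

end IsOrientedFrame

namespace IsMovingFrame

variable {lam : ℝ × ℝ → ℝ} {X Y l X' Y' l' : ℝ × ℝ → E3} {D : Set (ℝ × ℝ)} {p₀ : ℝ × ℝ}

/-- A moving frame which is orthonormal and right oriented at one point is so everywhere. -/
theorem isOrientedFrame (h : IsMovingFrame lam X Y l D) (hD : IsOpen D) (hc : IsPreconnected D)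
    (hp₀ : p₀ ∈ D) (h0 : IsOrientedFrame (X p₀) (Y p₀) (l p₀)) {p : ℝ × ℝ} (hp : p ∈ D) :
    IsOrientedFrame (X p) (Y p) (l p) := by
  have hdX := h.differentiable_X
  have hdY := h.differentiable_Y
  have hdl := h.differentiable_l
  -- The squared Frobenius norm of M - I for the Gram matrix M. The frame equations have a skew
  -- coefficient matrix Ω, so M - I changes by its commutator with Ω and this norm is constant.
  let Q : ℝ × ℝ → ℝ := fun p => (⟪X p, X p⟫ - 1) ^ 2 + (⟪Y p, Y p⟫ - 1) ^ 2 +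
    (⟪l p, l p⟫ - 1) ^ 2 + 2 * ⟪X p, Y p⟫ ^ 2 + 2 * ⟪X p, l p⟫ ^ 2 + 2 * ⟪Y p, l p⟫ ^ 2
  have hQf : ∀ p ∈ D, ∀ e, DifferentiableAt ℝ Q p ∧ fderiv ℝ Q p e =
      2 * (⟪X p, X p⟫ - 1) * fderiv ℝ (fun p => ⟪X p, X p⟫) p e +
      2 * (⟪Y p, Y p⟫ - 1) * fderiv ℝ (fun p => ⟪Y p, Y p⟫) p e +
      2 * (⟪l p, l p⟫ - 1) * fderiv ℝ (fun p => ⟪l p, l p⟫) p e +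
      4 * ⟪X p, Y p⟫ * fderiv ℝ (fun p => ⟪X p, Y p⟫) p e +
      4 * ⟪X p, l p⟫ * fderiv ℝ (fun p => ⟪X p, l p⟫) p e +
      4 * ⟪Y p, l p⟫ * fderiv ℝ (fun p => ⟪Y p, l p⟫) p e := by
    intro p hp e
    have d1 := ((hdX p hp).inner ℝ (hdX p hp)).hasFDerivAt
    have d2 := ((hdY p hp).inner ℝ (hdY p hp)).hasFDerivAt
    have d3 := ((hdl p hp).inner ℝ (hdl p hp)).hasFDerivAt
    have d4 := ((hdX p hp).inner ℝ (hdY p hp)).hasFDerivAt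
    have d5 := ((hdX p hp).inner ℝ (hdl p hp)).hasFDerivAt
    have d6 := ((hdY p hp).inner ℝ (hdl p hp)).hasFDerivAt
    have d : HasFDerivAt Q _ p :=
      (((((((d1.sub_const 1).pow 2).add ((d2.sub_const 1).pow 2)).add
        ((d3.sub_const 1).pow 2)).add ((d4.pow 2).const_mul 2)).add
        ((d5.pow 2).const_mul 2)).add ((d6.pow 2).const_mul 2))
    refine ⟨d.differentiableAt, ?_⟩
    rw [d.fderiv]
    simp
    ring
  have hu : ∀ p ∈ D, du Q p = 0 := by
    intro p hp
    have e := (hQf p hp (1, 0)).2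
    simp only [← du.eq_1] at e
    rw [e, du_inner (hdX p hp) (hdX p hp), du_inner (hdY p hp) (hdY p hp),
      du_inner (hdl p hp) (hdl p hp), du_inner (hdX p hp) (hdY p hp),
      du_inner (hdX p hp) (hdl p hp), du_inner (hdY p hp) (hdl p hp),
      h.du_X p hp, h.du_Y p hp, h.du_l p hp]
    simp only [inner_add_left, inner_add_right, real_inner_smul_left, real_inner_smul_right]
    rw [real_inner_comm (X p) (Y p), real_inner_comm (X p) (l p), real_inner_comm (Y p) (l p)]
    ring
  have hv : ∀ p ∈ D, dv Q p = 0 := by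
    intro p hp
    have e := (hQf p hp (0, 1)).2
    simp only [← dv.eq_1] at e
    rw [e, dv_inner (hdX p hp) (hdX p hp), dv_inner (hdY p hp) (hdY p hp),
      dv_inner (hdl p hp) (hdl p hp), dv_inner (hdX p hp) (hdY p hp),
      dv_inner (hdX p hp) (hdl p hp), dv_inner (hdY p hp) (hdl p hp),
      h.dv_X p hp, h.dv_Y p hp, h.dv_l p hp]
    simp only [inner_sub_left, inner_sub_right, real_inner_smul_left, real_inner_smul_right]
    rw [real_inner_comm (X p) (Y p), real_inner_comm (Y p) (l p)]
    ring
  have hQ : Q p = 0 := by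
    rw [eq_of_partials_eq_zero hD hc (fun p hp => (hQf p hp 0).1) hu hv hp hp₀]
    simp only [Q]
    rw [h0.inner_X, h0.inner_Y, h0.inner_l, h0.inner_XY, h0.inner_Xl, h0.inner_Yl]
    norm_num
  have hXX : ⟪X p, X p⟫ = 1 := by
    simp only [Q] at hQ; nlinarith
  have hYY : ⟪Y p, Y p⟫ = 1 := by
    simp only [Q] at hQ; nlinarith
  have hll : ⟪l p, l p⟫ = 1 := by
    simp only [Q] at hQ; nlinarith
  have hXY : ⟪X p, Y p⟫ = 0 := by
    simp only [Q] at hQ; nlinarith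
  refine ⟨hXX, hYY, hXY, eq_cross_of_inner_eq_one hXX hYY hll hXY ?_⟩
  have hdc : ∀ p ∈ D, DifferentiableAt ℝ (fun p => cross (X p) (Y p)) p := fun p hp =>
    differentiableAt_cross (hdX p hp) (hdY p hp)
  -- The triple product is constant because Ω has trace zero; its value 1 excludes the opposite
  -- orientation.
  have hconst := eq_of_partials_eq_zero (f := fun p => ⟪cross (X p) (Y p), l p⟫) hD hc
    (fun p hp => (hdc p hp).inner ℝ (hdl p hp)) ?_ ?_ hp hp₀
  · rw [hconst, ← h0.eq_cross, h0.inner_l]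
  · intro p hp
    rw [du_inner (hdc p hp) (hdl p hp), du_cross (hdX p hp) (hdY p hp), h.du_X p hp, h.du_Y p hp,
      h.du_l p hp]
    simp only [inner_eq_sum, cross_apply_zero, cross_apply_one, cross_apply_two, PiLp.add_apply,
      PiLp.smul_apply, smul_eq_mul]
    ring
  · intro p hp
    rw [dv_inner (hdc p hp) (hdl p hp), dv_cross (hdX p hp) (hdY p hp), h.dv_X p hp, h.dv_Y p hp,
      h.dv_l p hp]
    simp only [inner_eq_sum, cross_apply_zero, cross_apply_one, cross_apply_two, PiLp.add_apply,
      PiLp.sub_apply, PiLp.smul_apply, smul_eq_mul]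
    ring

/-- Two moving frames attached to the same function coincide if they do at one point. -/
theorem eq_of_eq_at (h : IsMovingFrame lam X Y l D) (h' : IsMovingFrame lam X' Y' l' D)
    (hD : IsOpen D) (hc : IsPreconnected D) (hp₀ : p₀ ∈ D) (eX : X p₀ = X' p₀) (eY : Y p₀ = Y' p₀)
    (el : l p₀ = l' p₀) {p : ℝ × ℝ} (hp : p ∈ D) : X p = X' p ∧ Y p = Y' p := by
  have dX : ∀ p ∈ D, DifferentiableAt ℝ (fun q => X q - X' q) p := fun p hp =>
    (h.differentiable_X p hp).fun_sub (h'.differentiable_X p hp)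
  have dY : ∀ p ∈ D, DifferentiableAt ℝ (fun q => Y q - Y' q) p := fun p hp =>
    (h.differentiable_Y p hp).fun_sub (h'.differentiable_Y p hp)
  have dl : ∀ p ∈ D, DifferentiableAt ℝ (fun q => l q - l' q) p := fun p hp =>
    (h.differentiable_l p hp).fun_sub (h'.differentiable_l p hp)
  -- The difference of the frames solves the same skew linear system, which preserves the sum of
  -- squared norms.
  let Q : ℝ × ℝ → ℝ := fun p => ⟪X p - X' p, X p - X' p⟫ + ⟪Y p - Y' p, Y p - Y' p⟫ +
    ⟪l p - l' p, l p - l' p⟫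
  have hQf : ∀ p ∈ D, ∀ e, DifferentiableAt ℝ Q p ∧ fderiv ℝ Q p e =
      fderiv ℝ (fun p => ⟪X p - X' p, X p - X' p⟫) p e +
      fderiv ℝ (fun p => ⟪Y p - Y' p, Y p - Y' p⟫) p e +
      fderiv ℝ (fun p => ⟪l p - l' p, l p - l' p⟫) p e := by
    intro p hp e
    have d : HasFDerivAt Q _ p := (((dX p hp).inner ℝ (dX p hp)).hasFDerivAt.add
      ((dY p hp).inner ℝ (dY p hp)).hasFDerivAt).add ((dl p hp).inner ℝ (dl p hp)).hasFDerivAt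
    refine ⟨d.differentiableAt, ?_⟩
    rw [d.fderiv]; rfl
  have hu : ∀ p ∈ D, du Q p = 0 := by
    intro p hp
    have e := (hQf p hp (1, 0)).2
    simp only [← du.eq_1] at e
    rw [e, du_inner (dX p hp) (dX p hp), du_inner (dY p hp) (dY p hp),
      du_inner (dl p hp) (dl p hp),
      du_sub (h.differentiable_X p hp) (h'.differentiable_X p hp),
      du_sub (h.differentiable_Y p hp) (h'.differentiable_Y p hp),
      du_sub (h.differentiable_l p hp) (h'.differentiable_l p hp),
      h.du_X p hp, h.du_Y p hp, h.du_l p hp, h'.du_X p hp, h'.du_Y p hp, h'.du_l p hp]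
    simp only [inner_eq_sum, PiLp.add_apply, PiLp.sub_apply, PiLp.smul_apply, smul_eq_mul]
    ring
  have hv : ∀ p ∈ D, dv Q p = 0 := by
    intro p hp
    have e := (hQf p hp (0, 1)).2
    simp only [← dv.eq_1] at e
    rw [e, dv_inner (dX p hp) (dX p hp), dv_inner (dY p hp) (dY p hp),
      dv_inner (dl p hp) (dl p hp),
      dv_sub (h.differentiable_X p hp) (h'.differentiable_X p hp),
      dv_sub (h.differentiable_Y p hp) (h'.differentiable_Y p hp),
      dv_sub (h.differentiable_l p hp) (h'.differentiable_l p hp),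
      h.dv_X p hp, h.dv_Y p hp, h.dv_l p hp, h'.dv_X p hp, h'.dv_Y p hp, h'.dv_l p hp]
    simp only [inner_eq_sum, PiLp.sub_apply, PiLp.smul_apply, smul_eq_mul]
    ring
  have hQ : Q p = 0 := by
    rw [eq_of_partials_eq_zero hD hc (fun p hp => (hQf p hp 0).1) hu hv hp hp₀]
    simp [Q, eX, eY, el]
  have n1 : 0 ≤ ⟪X p - X' p, X p - X' p⟫ := real_inner_self_nonneg
  have n2 : 0 ≤ ⟪Y p - Y' p, Y p - Y' p⟫ := real_inner_self_nonneg
  have n3 : 0 ≤ ⟪l p - l' p, l p - l' p⟫ := real_inner_self_nonneg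
  simp only [Q] at hQ
  exact ⟨sub_eq_zero.1 (inner_self_eq_zero (𝕜 := ℝ).1 (by linarith)),
    sub_eq_zero.1 (inner_self_eq_zero (𝕜 := ℝ).1 (by linarith))⟩

end IsMovingFrame

end MovingFrame

/-! ### Half-angle functions, and the surface belonging to a moving frame. -/

section HalfAngle

variable {lam : ℝ × ℝ → ℝ} {p : ℝ × ℝ}

theorem hasDerivAt_cos_half (t : ℝ) :
    HasDerivAt (fun t : ℝ => Real.cos (t / 2)) (-Real.sin (t / 2) / 2) t := by
  refine ((Real.hasDerivAt_cos _).comp t ((hasDerivAt_id t).div_const 2)).congr_deriv ?_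
  simp; ring

theorem hasDerivAt_sin_half (t : ℝ) :
    HasDerivAt (fun t : ℝ => Real.sin (t / 2)) (Real.cos (t / 2) / 2) t := by
  refine ((Real.hasDerivAt_sin _).comp t ((hasDerivAt_id t).div_const 2)).congr_deriv ?_
  simp; ring

theorem differentiableAt_cos_half (h : DifferentiableAt ℝ lam p) :
    DifferentiableAt ℝ (fun q => Real.cos (lam q / 2)) p :=
  ((hasDerivAt_cos_half _).comp_hasFDerivAt p h.hasFDerivAt).differentiableAt

theorem differentiableAt_sin_half (h : DifferentiableAt ℝ lam p) :
    DifferentiableAt ℝ (fun q => Real.sin (lam q / 2)) p :=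
  ((hasDerivAt_sin_half _).comp_hasFDerivAt p h.hasFDerivAt).differentiableAt

theorem sin_half_pos (h : 0 < lam p ∧ lam p < Real.pi / 2) : 0 < Real.sin (lam p / 2) :=
  Real.sin_pos_of_pos_of_lt_pi (by linarith [h.1]) (by linarith [h.2, Real.pi_pos])

theorem cos_half_pos (h : 0 < lam p ∧ lam p < Real.pi / 2) : 0 < Real.cos (lam p / 2) :=
  Real.cos_pos_of_mem_Ioo ⟨by linarith [h.1, Real.pi_pos], by linarith [h.2, Real.pi_pos]⟩

end HalfAngle

/-- Positivity of both factors matters: a negative product would reverse the normal. -/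
theorem unitNormal_eq {x : ℝ × ℝ → E3} {p : ℝ × ℝ} {X Y l : E3} {c s : ℝ} (hc : 0 < c) (hs : 0 < s)
    (h : IsOrientedFrame X Y l) (hu : du x p = c • X) (hv : dv x p = s • Y) :
    unitNormal x p = l := by
  have hl : ‖l‖ = 1 := by
    have := h.inner_l
    rw [real_inner_self_eq_norm_sq] at this
    nlinarith [norm_nonneg l]
  rw [unitNormal, hu, hv, cross_smul_smul, ← h.eq_cross, norm_smul, hl, mul_one, Real.norm_eq_abs,
    abs_of_pos (mul_pos hc hs), smul_smul, inv_mul_cancel₀ (mul_pos hc hs).ne', one_smul]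

/-- A surface with `x_u = cos (λ / 2) X` and `x_v = sin (λ / 2) Y` for an oriented moving frame
`X, Y, l` has the invariants prescribed by `λ`. -/
theorem isGeneratedBy_of_isMovingFrame {k : ℕ∞} {lam : ℝ × ℝ → ℝ} {X Y l x : ℝ × ℝ → E3}
    {S : Set (ℝ × ℝ)} (hS : IsOpen S) (hlam : ∀ p ∈ S, DifferentiableAt ℝ lam p)
    (hrange : ∀ p ∈ S, 0 < lam p ∧ lam p < Real.pi / 2) (hder : ∀ p ∈ S, du lam p * dv lam p ≠ 0)
    (h : IsMovingFrame lam X Y l S) (ho : ∀ p ∈ S, IsOrientedFrame (X p) (Y p) (l p))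
    (hx : ContDiffOn ℝ k x S) (hu : ∀ p ∈ S, du x p = Real.cos (lam p / 2) • X p)
    (hv : ∀ p ∈ S, dv x p = Real.sin (lam p / 2) • Y p) : IsGeneratedBy k lam x S := by
  have hE : ∀ p ∈ S, coeffE x p = Real.cos (lam p / 2) ^ 2 := fun p hp => by
    rw [coeffE, hu p hp, real_inner_smul_left, real_inner_smul_right, (ho p hp).inner_X]; ring
  have hF : ∀ p ∈ S, coeffF x p = 0 := fun p hp => by
    rw [coeffF, hu p hp, hv p hp, real_inner_smul_left, real_inner_smul_right,
      (ho p hp).inner_XY]; ring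
  have hG : ∀ p ∈ S, coeffG x p = Real.sin (lam p / 2) ^ 2 := fun p hp => by
    rw [coeffG, hv p hp, real_inner_smul_left, real_inner_smul_right, (ho p hp).inner_Y]; ring
  have hn : ∀ p ∈ S, unitNormal x p = l p := fun p hp =>
    unitNormal_eq (cos_half_pos (hrange p hp)) (sin_half_pos (hrange p hp)) (ho p hp) (hu p hp)
      (hv p hp)
  have hL : ∀ p ∈ S, coeffL x p = Real.cos (lam p / 2) * Real.sin (lam p / 2) := fun p hp => by
    rw [coeffL, hn p hp, du_congr hS hp hu, du_smul (differentiableAt_cos_half (hlam p hp))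
      (h.differentiable_X p hp), h.du_X p hp]
    simp only [inner_add_left, real_inner_smul_left, (ho p hp).inner_l, (ho p hp).inner_Xl,
      (ho p hp).inner_Yl]
    ring
  have hM : ∀ p ∈ S, coeffM x p = 0 := fun p hp => by
    rw [coeffM, hn p hp, dv_congr hS hp hu, dv_smul (differentiableAt_cos_half (hlam p hp))
      (h.differentiable_X p hp), h.dv_X p hp]
    simp only [inner_add_left, real_inner_smul_left, (ho p hp).inner_Xl, (ho p hp).inner_Yl]
    ring
  have hN : ∀ p ∈ S, coeffN x p = -(Real.cos (lam p / 2) * Real.sin (lam p / 2)) := fun p hp => by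
    rw [coeffN, hn p hp, dv_congr hS hp hv, dv_smul (differentiableAt_sin_half (hlam p hp))
      (h.differentiable_Y p hp), h.dv_Y p hp]
    simp only [inner_add_left, inner_sub_left, real_inner_smul_left, (ho p hp).inner_l,
      (ho p hp).inner_Xl, (ho p hp).inner_Yl]
    ring
  have hν₁ : ∀ p ∈ S, nu₁ x p = Real.tan (lam p / 2) := fun p hp => by
    have := cos_half_pos (hrange p hp)
    rw [nu₁, hL p hp, hE p hp, Real.tan_eq_sin_div_cos]; field_simp
  have hν₂ : ∀ p ∈ S, nu₂ x p = -Real.cot (lam p / 2) := fun p hp => by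
    have := sin_half_pos (hrange p hp)
    rw [nu₂, hN p hp, hG p hp, Real.cot_eq_cos_div_sin]; field_simp
  have hγ₁ : ∀ p ∈ S, gamma₁ x p = dv lam p / (2 * Real.cos (lam p / 2)) := fun p hp => by
    have hc := cos_half_pos (hrange p hp)
    have hs := sin_half_pos (hrange p hp)
    have e : ∀ t, HasDerivAt (fun t : ℝ => Real.cos (t / 2) ^ 2)
        (-Real.sin (t / 2) * Real.cos (t / 2)) t := fun t =>
      ((hasDerivAt_cos_half t).fun_pow 2).congr_deriv (by simp; ring)
    rw [gamma₁, hE p hp, hG p hp, Real.sqrt_sq hs.le, dv_congr hS hp hE,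
      dv_comp (e _) (hlam p hp)]
    field_simp
  have hγ₂ : ∀ p ∈ S, gamma₂ x p = du lam p / (2 * Real.sin (lam p / 2)) := fun p hp => by
    have hc := cos_half_pos (hrange p hp)
    have hs := sin_half_pos (hrange p hp)
    have e : ∀ t, HasDerivAt (fun t : ℝ => Real.sin (t / 2) ^ 2)
        (Real.sin (t / 2) * Real.cos (t / 2)) t := fun t =>
      ((hasDerivAt_sin_half t).fun_pow 2).congr_deriv (by simp; ring)
    rw [gamma₂, hE p hp, hG p hp, Real.sqrt_sq hc.le, du_congr hS hp hG,
      du_comp (e _) (hlam p hp)]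
    field_simp
  refine ⟨⟨hx, fun p hp => ?_, hF, hM, fun p hp => ?_⟩, fun p hp => ?_, hν₁, hν₂, hγ₁, hγ₂⟩
  · rw [LinearIndependent.pair_iff]
    intro a b hab
    have hc := cos_half_pos (hrange p hp)
    have hs := sin_half_pos (hrange p hp)
    rw [hu p hp, hv p hp] at hab
    have e1 := congrArg (fun w => ⟪w, X p⟫) hab
    have e2 := congrArg (fun w => ⟪w, Y p⟫) hab
    simp only [inner_add_left, real_inner_smul_left, (ho p hp).inner_X, (ho p hp).inner_Y,
      (ho p hp).inner_XY, (ho p hp).inner_YX, inner_zero_left] at e1 e2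
    refine ⟨?_, ?_⟩
    · simpa [hc.ne'] using e1
    · simpa [hs.ne'] using e2
  · have hc := cos_half_pos (hrange p hp)
    have hs := sin_half_pos (hrange p hp)
    have hne := mul_ne_zero_iff.1 (hder p hp)
    rw [hν₁ p hp, hν₂ p hp, hγ₁ p hp, hγ₂ p hp, Real.tan_eq_sin_div_cos, Real.cot_eq_cos_div_sin]
    refine mul_ne_zero (mul_ne_zero ?_ (div_ne_zero hne.2 (by positivity)))
      (div_ne_zero hne.1 (by positivity))
    rw [sub_neg_eq_add]
    positivity
  · have hc := cos_half_pos (hrange p hp)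
    have hs := sin_half_pos (hrange p hp)
    rw [gaussCurvature, hL p hp, hM p hp, hN p hp, hE p hp, hF p hp, hG p hp]
    field_simp
    ring

/-! ### The frame equations as a compatible linear system. -/

section Existence

/-- The elementary operator on quadruples of vectors that reads the entry `j` and puts it in
place `i`. -/
noncomputable def entryOp (i j : Fin 4) : (Fin 4 → E3) →L[ℝ] (Fin 4 → E3) :=
  (ContinuousLinearMap.single ℝ (fun _ : Fin 4 => E3) i).comp (ContinuousLinearMap.proj j)

theorem entryOp_apply (i j k : Fin 4) (w : Fin 4 → E3) :
    entryOp i j w k = if k = i then w j else 0 := by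
  simp [entryOp, Pi.single_apply]

/-- Coefficient of the frame equations in the `u` direction, for `w = (X, Y, l, x)`. -/
noncomputable def frameCoeffU (lam : ℝ × ℝ → ℝ) (p : ℝ × ℝ) : (Fin 4 → E3) →L[ℝ] (Fin 4 → E3) :=
  (2⁻¹ * dv lam p) • (entryOp 0 1 - entryOp 1 0) +
    Real.sin (lam p / 2) • (entryOp 0 2 - entryOp 2 0) + Real.cos (lam p / 2) • entryOp 3 0

/-- Coefficient of the frame equations in the `v` direction, for `w = (X, Y, l, x)`. -/
noncomputable def frameCoeffV (lam : ℝ × ℝ → ℝ) (p : ℝ × ℝ) : (Fin 4 → E3) →L[ℝ] (Fin 4 → E3) :=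
  (2⁻¹ * du lam p) • (entryOp 0 1 - entryOp 1 0) +
    Real.cos (lam p / 2) • (entryOp 2 1 - entryOp 1 2) + Real.sin (lam p / 2) • entryOp 3 1

variable {lam : ℝ × ℝ → ℝ} {D : Set (ℝ × ℝ)}

theorem contDiffOn_frameCoeffU {k m : WithTop ℕ∞} (hD : IsOpen D) (hlam : ContDiffOn ℝ k lam D)
    (h : m + 1 ≤ k) : ContDiffOn ℝ m (frameCoeffU lam) D := by
  have hl := (hlam.of_le (le_self_add.trans h)).div_const 2
  exact (((contDiffOn_const.mul (contDiffOn_dv hD hlam h)).smul contDiffOn_const).add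
    ((Real.contDiff_sin.comp_contDiffOn hl).smul contDiffOn_const)).add
    ((Real.contDiff_cos.comp_contDiffOn hl).smul contDiffOn_const)

theorem contDiffOn_frameCoeffV {k m : WithTop ℕ∞} (hD : IsOpen D) (hlam : ContDiffOn ℝ k lam D)
    (h : m + 1 ≤ k) : ContDiffOn ℝ m (frameCoeffV lam) D := by
  have hl := (hlam.of_le (le_self_add.trans h)).div_const 2
  exact (((contDiffOn_const.mul (contDiffOn_du hD hlam h)).smul contDiffOn_const).add
    ((Real.contDiff_cos.comp_contDiffOn hl).smul contDiffOn_const)).add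
    ((Real.contDiff_sin.comp_contDiffOn hl).smul contDiffOn_const)

/-- Only the entries coupling X and Y use the sine-Gordon equation; all others hold by the
derivatives of sin(λ/2) and cos(λ/2). The row of x expresses x_uv = x_vu. -/
theorem frameCoeff_compatible (hD : IsOpen D) (hlam : ContDiffOn ℝ 2 lam D)
    (hsol : ∀ p ∈ D, hypLaplacian lam p = Real.sin (lam p)) {p : ℝ × ℝ} (hp : p ∈ D)
    (w : Fin 4 → E3) :
    fderiv ℝ (frameCoeffU lam) p (0, 1) w + frameCoeffU lam p (frameCoeffV lam p w) =
      fderiv ℝ (frameCoeffV lam) p (1, 0) w + frameCoeffV lam p (frameCoeffU lam p w) := by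
  have hn := hD.mem_nhds hp
  have hl : DifferentiableAt ℝ lam p := (hlam.differentiableOn two_ne_zero).differentiableAt hn
  have hlu : DifferentiableAt ℝ (du lam) p :=
    ((contDiffOn_du (m := 1) hD hlam (by norm_num)).differentiableOn one_ne_zero).differentiableAt hn
  have hlv : DifferentiableAt ℝ (dv lam) p :=
    ((contDiffOn_dv (m := 1) hD hlam (by norm_num)).differentiableOn one_ne_zero).differentiableAt hn
  have ds := (hasDerivAt_sin_half _).comp_hasFDerivAt p hl.hasFDerivAt
  have dc := (hasDerivAt_cos_half _).comp_hasFDerivAt p hl.hasFDerivAt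
  have dU : HasFDerivAt (frameCoeffU lam) _ p :=
    (((hlv.hasFDerivAt.const_mul 2⁻¹).smul_const (entryOp 0 1 - entryOp 1 0)).add
      (ds.smul_const (entryOp 0 2 - entryOp 2 0))).add (dc.smul_const (entryOp 3 0))
  have dV : HasFDerivAt (frameCoeffV lam) _ p :=
    (((hlu.hasFDerivAt.const_mul 2⁻¹).smul_const (entryOp 0 1 - entryOp 1 0)).add
      (dc.smul_const (entryOp 2 1 - entryOp 1 2))).add (ds.smul_const (entryOp 3 1))
  have e := hsol p hp
  have e2 : Real.sin (lam p) = 2 * Real.sin (lam p / 2) * Real.cos (lam p / 2) := by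
    rw [← Real.sin_two_mul]; ring_nf
  rw [hypLaplacian, e2] at e
  have e3 : fderiv ℝ (du lam) p (1, 0) = du (du lam) p := rfl
  have e4 : fderiv ℝ (dv lam) p (0, 1) = dv (dv lam) p := rfl
  have e5 : fderiv ℝ lam p (1, 0) = du lam p := rfl
  have e6 : fderiv ℝ lam p (0, 1) = dv lam p := rfl
  have e7 : du (du lam) p = dv (dv lam) p + 2 * Real.sin (lam p / 2) * Real.cos (lam p / 2) := by
    linarith
  rw [dU.fderiv, dV.fderiv]
  ext k i
  fin_cases k <;>
  · simp [frameCoeffU, frameCoeffV, entryOp_apply, e3, e4, e5, e6, e7]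
    ring

end Existence

/-! ### Existence of the surface and its differentiability class. -/

section ExistenceTheorem

variable {lam : ℝ × ℝ → ℝ} {D : Set (ℝ × ℝ)}

theorem exists_isOrientedFrame : ∃ X Y l : E3, IsOrientedFrame X Y l := by
  refine ⟨EuclideanSpace.single 0 1, EuclideanSpace.single 1 1, _, ?_, ?_, ?_, rfl⟩ <;>
  simp [EuclideanSpace.inner_single_left]

/-- Local existence of the surface generated by a solution of the hyperbolic sine-Gordon
equation. -/
theorem exists_isGeneratedBy {n : ℕ∞} (hn : 2 ≤ n) (hD : IsOpen D) (hlam : ContDiffOn ℝ n lam D)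
    (hsol : ∀ p ∈ D, hypLaplacian lam p = Real.sin (lam p))
    (hrange : ∀ p ∈ D, 0 < lam p ∧ lam p < Real.pi / 2) (hder : ∀ p ∈ D, du lam p * dv lam p ≠ 0)
    {p₀ : ℝ × ℝ} (hp₀ : p₀ ∈ D) :
    ∃ r > 0, ball p₀ r ⊆ D ∧ ∃ x : ℝ × ℝ → E3, IsGeneratedBy (n + 1) lam x (ball p₀ r) := by
  have hn' : ((2 : ℕ∞) : WithTop ℕ∞) ≤ (n : WithTop ℕ∞) := WithTop.coe_le_coe.2 hn
  have hlam2 : ContDiffOn ℝ 2 lam D := hlam.of_le hn'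
  obtain ⟨X₀, Y₀, l₀, h₀⟩ := exists_isOrientedFrame
  obtain ⟨r, hr, hrD, F, hF0, hF⟩ := exists_solution_of_compatible hD
    (contDiffOn_frameCoeffU (m := 1) hD hlam2 (by norm_num))
    (contDiffOn_frameCoeffV (m := 1) hD hlam2 (by norm_num))
    (fun p hp w => frameCoeff_compatible hD hlam2 hsol hp w) hp₀ ![X₀, Y₀, l₀, 0]
  have hS : IsOpen (ball p₀ r) := isOpen_ball
  have hFd : ∀ i, ∀ p ∈ ball p₀ r, DifferentiableAt ℝ (fun q => F q i) p := fun i p hp =>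
    (ContinuousLinearMap.proj (R := ℝ) (φ := fun _ : Fin 4 => E3) i).differentiableAt.comp p
      (hF p hp).1
  have hFu : ∀ i, ∀ p ∈ ball p₀ r, du (fun q => F q i) p = frameCoeffU lam p (F p) i :=
    fun i p hp => by
      rw [← (hF p hp).2.1]
      exact du_clm (ContinuousLinearMap.proj (R := ℝ) (φ := fun _ : Fin 4 => E3) i) (hF p hp).1
  have hFv : ∀ i, ∀ p ∈ ball p₀ r, dv (fun q => F q i) p = frameCoeffV lam p (F p) i :=
    fun i p hp => by
      rw [← (hF p hp).2.2]
      exact dv_clm (ContinuousLinearMap.proj (R := ℝ) (φ := fun _ : Fin 4 => E3) i) (hF p hp).1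
  have hframe : IsMovingFrame lam (fun q => F q 0) (fun q => F q 1) (fun q => F q 2)
      (ball p₀ r) := by
    refine ⟨hFd 0, hFd 1, hFd 2, fun p hp => ?_, fun p hp => ?_, fun p hp => ?_, fun p hp => ?_,
      fun p hp => ?_, fun p hp => ?_⟩ <;>
    simp only [hFu _ p hp, hFv _ p hp] <;>
    simp [frameCoeffU, frameCoeffV, entryOp_apply, div_eq_inv_mul, sub_eq_add_neg]
  have hu : ∀ p ∈ ball p₀ r, du (fun q => F q 3) p = Real.cos (lam p / 2) • F p 0 :=
    fun p hp => by rw [hFu _ p hp]; simp [frameCoeffU, entryOp_apply]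
  have hv : ∀ p ∈ ball p₀ r, dv (fun q => F q 3) p = Real.sin (lam p / 2) • F p 1 :=
    fun p hp => by rw [hFv _ p hp]; simp [frameCoeffV, entryOp_apply]
  have hFk : ∀ k : ℕ, (k : ℕ∞) ≤ n → ContDiffOn ℝ k F (ball p₀ r) := by
    intro k hk
    cases k with
    | zero => exact contDiffOn_zero.2 fun p hp => (hF p hp).1.continuousAt.continuousWithinAt
    | succ k =>
      have hk' : ((k : ℕ) : WithTop ℕ∞) + 1 ≤ (n : WithTop ℕ∞) := by exact_mod_cast hk
      exact contDiffOn_of_linear_system hS hF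
        ((contDiffOn_frameCoeffU hD hlam hk').mono hrD)
        ((contDiffOn_frameCoeffV hD hlam hk').mono hrD)
  have hxk : ∀ k : ℕ, (k : ℕ∞) ≤ n → ContDiffOn ℝ (k + 1 : ℕ) (fun q => F q 3) (ball p₀ r) := by
    intro k hk
    have hl : ContDiffOn ℝ k (fun q => lam q / 2) (ball p₀ r) :=
      ((hlam.of_le (by exact_mod_cast hk)).mono hrD).div_const 2
    have hc := contDiffOn_pi.1 (hFk k hk)
    exact contDiffOn_succ_of_partials hS (hFd 3)
      (((Real.contDiff_cos.comp_contDiffOn hl).smul (hc 0)).congr hu)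
      (((Real.contDiff_sin.comp_contDiffOn hl).smul (hc 1)).congr hv)
  have hx : ContDiffOn ℝ ((n + 1 : ℕ∞) : WithTop ℕ∞) (fun q => F q 3) (ball p₀ r) := by
    -- Passing to finite orders m ≤ n + 1 also covers n = ∞. Truncated subtraction in m - 1 means
    -- that m = 0 is deduced from class C¹.
    rw [contDiffOn_iff_forall_nat_le]
    intro m hm
    refine (hxk (m - 1) ?_).of_le (by exact_mod_cast (by omega : m ≤ m - 1 + 1))
    cases m with
    | zero => simp
    | succ m =>
      rw [Nat.add_sub_cancel]
      push_cast at hm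
      exact (ENat.add_le_add_iff_right ENat.one_ne_top).1 hm
  refine ⟨r, hr, hrD, _, isGeneratedBy_of_isMovingFrame hS
    (fun p hp => (hlam2.differentiableOn two_ne_zero).differentiableAt (hD.mem_nhds (hrD hp)))
    (fun p hp => hrange p (hrD hp)) (fun p hp => hder p (hrD hp)) hframe (fun p hp => ?_) hx hu hv⟩
  refine hframe.isOrientedFrame hS (convex_ball p₀ r).isPreconnected (mem_ball_self hr) ?_ hp
  simpa [hF0] using h₀

end ExistenceTheorem

/-! ### Rotations, and invariance of the surface data under motions. -/

section Motion

/-- The triple product is the determinant with respect to the standard basis, so a linear map scales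
it by its own determinant. -/
theorem inner_cross_map (A : E3 →ₗ[ℝ] E3) (a b c : E3) :
    ⟪cross (A a) (A b), A c⟫ = LinearMap.det A * ⟪cross a b, c⟫ := by
  have key : ∀ a b c : E3, ⟪cross a b, c⟫ =
      (EuclideanSpace.basisFun (Fin 3) ℝ).toBasis.det ![a, b, c] := by
    intro a b c
    simp only [Module.Basis.det_apply, Matrix.det_fin_three, Module.Basis.toMatrix_apply,
      inner_eq_sum, cross_apply_zero, cross_apply_one, cross_apply_two]
    simp
    ring
  rw [key, key, ← Module.Basis.det_comp]
  congr 1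
  funext i
  fin_cases i <;> rfl

/-- A nonzero triple product makes a, b, c a basis; any vector is recovered from its inner products
through the reciprocal basis b × c, c × a, a × b. -/
theorem eq_of_inner_eq {a b c w w' : E3} (h : ⟪cross a b, c⟫ ≠ 0) (ha : ⟪w, a⟫ = ⟪w', a⟫)
    (hb : ⟪w, b⟫ = ⟪w', b⟫) (hc : ⟪w, c⟫ = ⟪w', c⟫) : w = w' := by
  have key : ∀ d : E3, ⟪cross a b, c⟫ • d =
      ⟪d, a⟫ • cross b c + ⟪d, b⟫ • cross c a + ⟪d, c⟫ • cross a b := by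
    intro d
    ext i
    fin_cases i <;>
    · simp [inner_eq_sum, cross_apply_zero, cross_apply_one, cross_apply_two]
      ring
  have e := key w
  rw [ha, hb, hc, ← key w'] at e
  exact smul_right_injective _ h e

theorem cross_map {A : E3 ≃ₗᵢ[ℝ] E3}
    (hA : LinearMap.det (A.toLinearEquiv : E3 →ₗ[ℝ] E3) = 1) (a b : E3) :
    cross (A a) (A b) = A (cross a b) := by
  refine ext_inner_right ℝ fun w => ?_
  obtain ⟨c, rfl⟩ := A.surjective w
  rw [A.inner_map_map]
  have := inner_cross_map (A.toLinearEquiv : E3 →ₗ[ℝ] E3) a b c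
  rw [hA, one_mul] at this
  exact this

variable {k : ℕ∞} {lam : ℝ × ℝ → ℝ} {x y : ℝ × ℝ → E3} {D : Set (ℝ × ℝ)}

/-- The property of being generated by `lam` only depends on the fundamental forms. -/
theorem IsGeneratedBy.congr (h : IsGeneratedBy k lam x D) (hD : IsOpen D)
    (hy : ContDiffOn ℝ k y D) (hi : ∀ p ∈ D, LinearIndependent ℝ ![du y p, dv y p])
    (hE : ∀ p ∈ D, coeffE y p = coeffE x p) (hF : ∀ p ∈ D, coeffF y p = coeffF x p)
    (hG : ∀ p ∈ D, coeffG y p = coeffG x p) (hL : ∀ p ∈ D, coeffL y p = coeffL x p)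
    (hM : ∀ p ∈ D, coeffM y p = coeffM x p) (hN : ∀ p ∈ D, coeffN y p = coeffN x p) :
    IsGeneratedBy k lam y D := by
  have h1 : ∀ p ∈ D, nu₁ y p = nu₁ x p := fun p hp => by rw [nu₁, nu₁, hL p hp, hE p hp]
  have h2 : ∀ p ∈ D, nu₂ y p = nu₂ x p := fun p hp => by rw [nu₂, nu₂, hN p hp, hG p hp]
  have h3 : ∀ p ∈ D, gamma₁ y p = gamma₁ x p := fun p hp => by
    rw [gamma₁, gamma₁, hE p hp, hG p hp, dv_congr hD hp hE]
  have h4 : ∀ p ∈ D, gamma₂ y p = gamma₂ x p := fun p hp => by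
    rw [gamma₂, gamma₂, hE p hp, hG p hp, du_congr hD hp hG]
  refine ⟨⟨hy, hi, fun p hp => ?_, fun p hp => ?_, fun p hp => ?_⟩, fun p hp => ?_, fun p hp => ?_,
    fun p hp => ?_, fun p hp => ?_, fun p hp => ?_⟩
  · rw [hF p hp, h.surface.coeffF_eq_zero p hp]
  · rw [hM p hp, h.surface.coeffM_eq_zero p hp]
  · rw [h1 p hp, h2 p hp, h3 p hp, h4 p hp]; exact h.surface.strongly_regular p hp
  · rw [gaussCurvature, hE p hp, hF p hp, hG p hp, hL p hp, hM p hp, hN p hp]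
    exact h.gaussCurvature_eq p hp
  · rw [h1 p hp, h.nu₁_eq p hp]
  · rw [h2 p hp, h.nu₂_eq p hp]
  · rw [h3 p hp, h.gamma₁_eq p hp]
  · rw [h4 p hp, h.gamma₂_eq p hp]

/-- The linear part A carries the first and second derivatives of x to those of y. Since det A = 1
it also carries the normal to the normal, so both fundamental forms agree. -/
theorem IsGeneratedBy.comp_motion (hk : 2 ≤ k) (h : IsGeneratedBy k lam x D) (hD : IsOpen D)
    {T : E3 → E3} (hT : IsMotion T) (hy : EqOn y (T ∘ x) D) : IsGeneratedBy k lam y D := by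
  obtain ⟨A, b, hdet, hTA⟩ := hT
  have hx := h.surface.contDiffOn
  have hk' : ((2 : ℕ∞) : WithTop ℕ∞) ≤ (k : WithTop ℕ∞) := WithTop.coe_le_coe.2 hk
  have hx2 : ContDiffOn ℝ 2 x D := hx.of_le hk'
  have hd : ∀ p ∈ D, DifferentiableAt ℝ x p := fun p hp =>
    (hx2.differentiableOn two_ne_zero).differentiableAt (hD.mem_nhds hp)
  have hdu : ∀ p ∈ D, DifferentiableAt ℝ (du x) p := fun p hp =>
    ((contDiffOn_du (m := 1) hD hx2 (by norm_num)).differentiableOn one_ne_zero).differentiableAt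
      (hD.mem_nhds hp)
  have hdv : ∀ p ∈ D, DifferentiableAt ℝ (dv x) p := fun p hp =>
    ((contDiffOn_dv (m := 1) hD hx2 (by norm_num)).differentiableOn one_ne_zero).differentiableAt
      (hD.mem_nhds hp)
  let A' : E3 →L[ℝ] E3 := A.toContinuousLinearEquiv
  have hy' : EqOn y (fun p => A' (x p) + b) D := fun p hp => by
    rw [hy hp]; exact hTA _
  have hyu : ∀ p ∈ D, du y p = A' (du x p) := fun p hp => by
    rw [du_congr hD hp hy', ← du_clm A' (hd p hp)]
    simp [du]
  have hyv : ∀ p ∈ D, dv y p = A' (dv x p) := fun p hp => by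
    rw [dv_congr hD hp hy', ← dv_clm A' (hd p hp)]
    simp [dv]
  have hyuu : ∀ p ∈ D, du (du y) p = A' (du (du x) p) := fun p hp => by
    rw [du_congr hD hp hyu, du_clm A' (hdu p hp)]
  have hyuv : ∀ p ∈ D, dv (du y) p = A' (dv (du x) p) := fun p hp => by
    rw [dv_congr hD hp hyu, dv_clm A' (hdu p hp)]
  have hyvv : ∀ p ∈ D, dv (dv y) p = A' (dv (dv x) p) := fun p hp => by
    rw [dv_congr hD hp hyv, dv_clm A' (hdv p hp)]
  have hn : ∀ p ∈ D, unitNormal y p = A' (unitNormal x p) := fun p hp => by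
    have e : cross (du y p) (dv y p) = A (cross (du x p) (dv x p)) := by
      rw [hyu p hp, hyv p hp]; exact cross_map hdet _ _
    rw [unitNormal, unitNormal, e, A.norm_map, map_smul]
    rfl
  have hin : ∀ a b : E3, ⟪A' a, A' b⟫ = ⟪a, b⟫ := fun a b => A.inner_map_map a b
  refine h.congr hD ?_ (fun p hp => ?_) (fun p hp => ?_) (fun p hp => ?_) (fun p hp => ?_)
    (fun p hp => ?_) (fun p hp => ?_) (fun p hp => ?_)
  · exact ((A'.contDiff.comp_contDiffOn hx).add contDiffOn_const).congr hy'
  · rw [LinearIndependent.pair_iff]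
    intro s t hst
    rw [hyu p hp, hyv p hp, ← map_smul, ← map_smul, ← map_add] at hst
    exact LinearIndependent.pair_iff.1 (h.surface.immersion p hp) s t
      (A.injective (hst.trans (map_zero A).symm))
  · rw [coeffE, coeffE, hyu p hp, hin]
  · rw [coeffF, coeffF, hyu p hp, hyv p hp, hin]
  · rw [coeffG, coeffG, hyv p hp, hin]
  · rw [coeffL, coeffL, hyuu p hp, hn p hp, hin]
  · rw [coeffM, coeffM, hyuv p hp, hn p hp, hin]
  · rw [coeffN, coeffN, hyvv p hp, hn p hp, hin]

/-- The isometry that carries one oriented frame to another is a rotation. -/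
theorem exists_isometry_of_isOrientedFrame {X Y l X' Y' l' : E3} (h : IsOrientedFrame X Y l)
    (h' : IsOrientedFrame X' Y' l') : ∃ A : E3 ≃ₗᵢ[ℝ] E3,
      LinearMap.det (A.toLinearEquiv : E3 →ₗ[ℝ] E3) = 1 ∧ A X = X' ∧ A Y = Y' ∧ A l = l' := by
  have key : ∀ {X Y l : E3}, IsOrientedFrame X Y l →
      ∃ e : OrthonormalBasis (Fin 3) ℝ E3, e 0 = X ∧ e 1 = Y ∧ e 2 = l := by
    intro X Y l h
    have ho : Orthonormal ℝ ![X, Y, l] := by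
      rw [orthonormal_iff_ite]
      intro i j
      fin_cases i <;> fin_cases j <;>
        simp only [Fin.zero_eta, Fin.mk_one, Fin.reduceFinMk, Matrix.cons_val] <;>
        simp only [h.inner_X, h.inner_Y, h.inner_l, h.inner_XY, h.inner_Xl, h.inner_Yl,
          h.inner_YX, h.inner_lX, h.inner_lY] <;> simp
    have hcard : Fintype.card (Fin 3) = Module.finrank ℝ E3 := by simp
    let e := (basisOfOrthonormalOfCardEqFinrank ho hcard).toOrthonormalBasis (by
      rw [coe_basisOfOrthonormalOfCardEqFinrank]; exact ho)
    have he : ∀ i, e i = ![X, Y, l] i := fun i => by simp [e]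
    exact ⟨e, he 0, he 1, he 2⟩
  obtain ⟨e, e0, e1, e2⟩ := key h
  obtain ⟨f, f0, f1, f2⟩ := key h'
  have hA : ∀ i, e.equiv f (Equiv.refl _) (e i) = f i := fun i => by simp
  have a0 := hA 0
  have a1 := hA 1
  have a2 := hA 2
  rw [e0, f0] at a0
  rw [e1, f1] at a1
  rw [e2, f2] at a2
  refine ⟨e.equiv f (Equiv.refl _), ?_, a0, a1, a2⟩
  -- The triple product of an oriented frame is 1, so det A is the triple product of the image
  -- frame, again 1.
  have hd := inner_cross_map ((e.equiv f (Equiv.refl _)).toLinearEquiv : E3 →ₗ[ℝ] E3) X Y l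
  rw [← h.eq_cross, h.inner_l, mul_one] at hd
  rw [← hd]
  change ⟪cross (e.equiv f (Equiv.refl _) X) (e.equiv f (Equiv.refl _) Y),
    e.equiv f (Equiv.refl _) l⟫ = 1
  rw [a0, a1, a2, ← h'.eq_cross, h'.inner_l]

/-- The frame equations are linear with scalar coefficients, so a constant linear map preserves
them, whether or not it is an isometry. -/
theorem IsMovingFrame.map {X Y l : ℝ × ℝ → E3} (h : IsMovingFrame lam X Y l D) (A : E3 →L[ℝ] E3) :
    IsMovingFrame lam (fun p => A (X p)) (fun p => A (Y p)) (fun p => A (l p)) D where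
  differentiable_X p hp := A.differentiableAt.comp p (h.differentiable_X p hp)
  differentiable_Y p hp := A.differentiableAt.comp p (h.differentiable_Y p hp)
  differentiable_l p hp := A.differentiableAt.comp p (h.differentiable_l p hp)
  du_X p hp := by rw [du_clm A (h.differentiable_X p hp), h.du_X p hp]; simp
  dv_X p hp := by rw [dv_clm A (h.differentiable_X p hp), h.dv_X p hp]; simp
  du_Y p hp := by rw [du_clm A (h.differentiable_Y p hp), h.du_Y p hp]; simp
  dv_Y p hp := by rw [dv_clm A (h.differentiable_Y p hp), h.dv_Y p hp]; simp
  du_l p hp := by rw [du_clm A (h.differentiable_l p hp), h.du_l p hp]; simp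
  dv_l p hp := by rw [dv_clm A (h.differentiable_l p hp), h.dv_l p hp]; simp

end Motion

/-! ### Recovery of the frame from the invariants, and uniqueness up to a motion. -/

section Uniqueness

variable {lam : ℝ × ℝ → ℝ} {x y : ℝ × ℝ → E3} {D : Set (ℝ × ℝ)}

/-- The normalized principal frame of a surface generated by `lam` satisfies the frame equations
of `lam`: the Codazzi equations force `√E = cos (λ / 2)` and `√G = sin (λ / 2)`. -/
theorem IsGeneratedBy.exists_isMovingFrame (h : IsGeneratedBy 3 lam x D) (hD : IsOpen D)
    (hlam : ∀ p ∈ D, DifferentiableAt ℝ lam p)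
    (hrange : ∀ p ∈ D, 0 < lam p ∧ lam p < Real.pi / 2)
    (hder : ∀ p ∈ D, du lam p * dv lam p ≠ 0) :
    ∃ X Y l : ℝ × ℝ → E3, IsMovingFrame lam X Y l D ∧
      ∀ p ∈ D, IsOrientedFrame (X p) (Y p) (l p) ∧ du x p = Real.cos (lam p / 2) • X p ∧
        dv x p = Real.sin (lam p / 2) • Y p := by
  have hx := h.surface.contDiffOn
  have cu : ContDiffOn ℝ 2 (du x) D := contDiffOn_du hD hx (by norm_num)
  have cv : ContDiffOn ℝ 2 (dv x) D := contDiffOn_dv hD hx (by norm_num)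
  have ccr : ContDiffOn ℝ 2 (fun p => cross (du x p) (dv x p)) D :=
    (crossL.contDiff.comp_contDiffOn cu).clm_apply cv
  have hdiff : ∀ {f : ℝ × ℝ → E3}, ContDiffOn ℝ 2 f D → ∀ p ∈ D, DifferentiableAt ℝ f p :=
    fun hf p hp => (hf.differentiableOn two_ne_zero).differentiableAt (hD.mem_nhds hp)
  have du₀ := hdiff cu
  have dv₀ := hdiff cv
  have hne : ∀ p ∈ D, du x p ≠ 0 ∧ dv x p ≠ 0 := fun p hp =>
    ⟨(h.surface.immersion p hp).ne_zero 0, (h.surface.immersion p hp).ne_zero 1⟩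
  have hE : ∀ p ∈ D, 0 < coeffE x p := fun p hp => real_inner_self_pos.2 (hne p hp).1
  have hG : ∀ p ∈ D, 0 < coeffG x p := fun p hp => real_inner_self_pos.2 (hne p hp).2
  have hF := h.surface.coeffF_eq_zero
  have hcr : ∀ p ∈ D, 0 < ‖cross (du x p) (dv x p)‖ := fun p hp => by
    have e := inner_cross_cross (du x p) (dv x p)
    have eF : ⟪du x p, dv x p⟫ = 0 := hF p hp
    rw [eF] at e
    rw [norm_pos_iff, ← real_inner_self_pos, e]
    have : 0 < ⟪du x p, du x p⟫ * ⟪dv x p, dv x p⟫ := mul_pos (hE p hp) (hG p hp)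
    linarith
  -- Class C³ of x is needed here: the normal becomes C², so its mixed derivatives agree.
  have cn : ContDiffOn ℝ 2 (unitNormal x) D :=
    ((ccr.norm ℝ fun p hp => norm_pos_iff.1 (hcr p hp)).inv fun p hp => (hcr p hp).ne').smul ccr
  have dn := hdiff cn
  have inn : ∀ p ∈ D, ⟪unitNormal x p, unitNormal x p⟫ = 1 := fun p hp => by
    rw [unitNormal, real_inner_smul_left, real_inner_smul_right, real_inner_self_eq_norm_sq]
    field_simp [(hcr p hp).ne']
  have inu : ∀ p ∈ D, ⟪unitNormal x p, du x p⟫ = 0 := fun p hp => by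
    rw [unitNormal, real_inner_smul_left, inner_cross_left, mul_zero]
  have inv' : ∀ p ∈ D, ⟪unitNormal x p, dv x p⟫ = 0 := fun p hp => by
    rw [unitNormal, real_inner_smul_left, inner_cross_right, mul_zero]
  have hbasis : ∀ p ∈ D, ⟪cross (du x p) (dv x p), unitNormal x p⟫ ≠ 0 := fun p hp => by
    rw [unitNormal, real_inner_smul_right, real_inner_self_eq_norm_sq]
    have := hcr p hp
    positivity
  have hmix : ∀ p ∈ D, du (dv x) p = dv (du x) p := fun p hp =>
    du_dv_comm ((hx.contDiffAt (hD.mem_nhds hp)).of_le (by norm_num))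
  have hLe : ∀ p ∈ D, coeffL x p =
      Real.sin (lam p / 2) / Real.cos (lam p / 2) * coeffE x p := fun p hp => by
    have := h.nu₁_eq p hp
    rw [nu₁, Real.tan_eq_sin_div_cos, div_eq_iff (hE p hp).ne'] at this
    exact this
  have hNe : ∀ p ∈ D, coeffN x p =
      -(Real.cos (lam p / 2) / Real.sin (lam p / 2)) * coeffG x p := fun p hp => by
    have := h.nu₂_eq p hp
    rw [nu₂, Real.cot_eq_cos_div_sin, div_eq_iff (hG p hp).ne'] at this
    exact this
  -- Rodrigues' formula: differentiating ⟪l, l⟫ = 1 and ⟪l, x_u⟫ = ⟪l, x_v⟫ = 0 gives the components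
  -- of l_u against x_u, x_v, l.
  have hdnu : ∀ p ∈ D, du (unitNormal x) p =
      (-(Real.sin (lam p / 2) / Real.cos (lam p / 2))) • du x p := by
    intro p hp
    have e1 := du_congr hD hp (g := fun _ => (1 : ℝ)) inn
    have e2 := du_congr hD hp (g := fun _ => (0 : ℝ)) inu
    have e3 := du_congr hD hp (g := fun _ => (0 : ℝ)) inv'
    rw [du_inner (dn p hp) (dn p hp), du_const, real_inner_comm] at e1
    rw [du_inner (dn p hp) (du₀ p hp), du_const, real_inner_comm] at e2
    rw [du_inner (dn p hp) (dv₀ p hp), du_const, hmix p hp, real_inner_comm] at e3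
    have eL : ⟪du (du x) p, unitNormal x p⟫ = _ := hLe p hp
    have eM : ⟪dv (du x) p, unitNormal x p⟫ = 0 := h.surface.coeffM_eq_zero p hp
    have eF : ⟪du x p, dv x p⟫ = 0 := hF p hp
    refine eq_of_inner_eq (hbasis p hp) ?_ ?_ ?_ <;> rw [real_inner_smul_left]
    · rw [eL] at e2; rw [coeffE] at e2; linarith
    · rw [eF]; linarith
    · rw [real_inner_comm (unitNormal x p) (du x p), inu p hp]; linarith
  have hdnv : ∀ p ∈ D, dv (unitNormal x) p =
      (Real.cos (lam p / 2) / Real.sin (lam p / 2)) • dv x p := by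
    intro p hp
    have e1 := dv_congr hD hp (g := fun _ => (1 : ℝ)) inn
    have e2 := dv_congr hD hp (g := fun _ => (0 : ℝ)) inu
    have e3 := dv_congr hD hp (g := fun _ => (0 : ℝ)) inv'
    rw [dv_inner (dn p hp) (dn p hp), dv_const, real_inner_comm] at e1
    rw [dv_inner (dn p hp) (du₀ p hp), dv_const, real_inner_comm] at e2
    rw [dv_inner (dn p hp) (dv₀ p hp), dv_const, real_inner_comm] at e3
    have eN : ⟪dv (dv x) p, unitNormal x p⟫ = _ := hNe p hp
    have eM : ⟪dv (du x) p, unitNormal x p⟫ = 0 := h.surface.coeffM_eq_zero p hp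
    have eF : ⟪dv x p, du x p⟫ = 0 := by rw [real_inner_comm]; exact hF p hp
    refine eq_of_inner_eq (hbasis p hp) ?_ ?_ ?_ <;> rw [real_inner_smul_left]
    · rw [eF]; linarith
    · rw [eN] at e3; rw [coeffG] at e3; linarith
    · rw [real_inner_comm (unitNormal x p) (dv x p), inv' p hp]; linarith
  -- Codazzi: l_uv = l_vu becomes an equation for x_uv with factor cot(λ/2) + tan(λ/2) = 1/(sin(λ/2)
  -- cos(λ/2)), which is invertible.
  have hxuv : ∀ p ∈ D, dv (du x) p =
      (-(Real.sin (lam p / 2) * dv lam p / (2 * Real.cos (lam p / 2)))) • du x p +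
      (Real.cos (lam p / 2) * du lam p / (2 * Real.sin (lam p / 2))) • dv x p := by
    intro p hp
    have hc := cos_half_pos (hrange p hp)
    have hs := sin_half_pos (hrange p hp)
    have hsc := Real.sin_sq_add_cos_sq (lam p / 2)
    have dt := ((hasDerivAt_sin_half (lam p)).fun_div (hasDerivAt_cos_half (lam p)) hc.ne').fun_neg
    have dct := (hasDerivAt_cos_half (lam p)).fun_div (hasDerivAt_sin_half (lam p)) hs.ne'
    have e := du_dv_comm (cn.contDiffAt (hD.mem_nhds hp))
    rw [du_congr hD hp hdnv, dv_congr hD hp hdnu,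
      du_smul (a := fun q => Real.cos (lam q / 2) / Real.sin (lam q / 2))
        (dct.comp_hasFDerivAt p (hlam p hp).hasFDerivAt).differentiableAt (dv₀ p hp),
      dv_smul (a := fun q => -(Real.sin (lam q / 2) / Real.cos (lam q / 2)))
        (dt.comp_hasFDerivAt p (hlam p hp).hasFDerivAt).differentiableAt (du₀ p hp),
      du_comp dct (hlam p hp), dv_comp dt (hlam p hp), hmix p hp] at e
    have e' : (Real.cos (lam p / 2) / Real.sin (lam p / 2) +
        Real.sin (lam p / 2) / Real.cos (lam p / 2)) • dv (du x) p =
        (-(dv lam p / (2 * Real.cos (lam p / 2) ^ 2))) • du x p +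
        (du lam p / (2 * Real.sin (lam p / 2) ^ 2)) • dv x p := by
      have t1 : -((Real.cos (lam p / 2) / 2 * Real.cos (lam p / 2) -
          Real.sin (lam p / 2) * (-Real.sin (lam p / 2) / 2)) / Real.cos (lam p / 2) ^ 2) *
          dv lam p = -(dv lam p / (2 * Real.cos (lam p / 2) ^ 2)) := by
        field_simp; linear_combination (-dv lam p) * hsc
      have t2 : (-Real.sin (lam p / 2) / 2 * Real.sin (lam p / 2) -
          Real.cos (lam p / 2) * (Real.cos (lam p / 2) / 2)) / Real.sin (lam p / 2) ^ 2 *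
          du lam p = -(du lam p / (2 * Real.sin (lam p / 2) ^ 2)) := by
        field_simp; linear_combination (-du lam p) * hsc
      rw [t1, t2] at e
      refine sub_eq_zero.1 (Eq.trans ?_ (sub_eq_zero.2 e))
      module
    have hcs : Real.cos (lam p / 2) / Real.sin (lam p / 2) +
        Real.sin (lam p / 2) / Real.cos (lam p / 2) =
        (Real.sin (lam p / 2) * Real.cos (lam p / 2))⁻¹ := by
      field_simp; linarith
    rw [hcs, inv_smul_eq_iff₀ (mul_pos hs hc).ne', smul_add, smul_smul, smul_smul] at e'
    rw [e']
    congr 2 <;> field_simp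
  -- From x_uv, E_v = -tan(λ/2) λ_v E, so γ₁ = tan(λ/2) λ_v / (2√G). Equating this with the
  -- prescribed γ₁ and cancelling λ_v ≠ 0 gives √G.
  have hsqrtG : ∀ p ∈ D, Real.sqrt (coeffG x p) = Real.sin (lam p / 2) := by
    intro p hp
    have hc := cos_half_pos (hrange p hp)
    have hs := sin_half_pos (hrange p hp)
    have hE' := hE p hp
    have hsq := Real.sqrt_pos.2 (hG p hp)
    have eF : ⟪du x p, dv x p⟫ = 0 := hF p hp
    have e := h.gamma₁_eq p hp
    have eE : dv (coeffE x) p =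
        -(Real.sin (lam p / 2) * dv lam p / Real.cos (lam p / 2)) * coeffE x p := by
      have : dv (coeffE x) p = ⟪du x p, dv (du x) p⟫ + ⟪dv (du x) p, du x p⟫ :=
        dv_inner (du₀ p hp) (du₀ p hp)
      rw [this, real_inner_comm (du x p), hxuv p hp, inner_add_right, real_inner_smul_right,
        real_inner_smul_right, eF, coeffE]
      field_simp; ring
    rw [gamma₁, eE] at e
    have hv0 := (mul_ne_zero_iff.1 (hder p hp)).2
    field_simp at e
    linarith
  have hsqrtE : ∀ p ∈ D, Real.sqrt (coeffE x p) = Real.cos (lam p / 2) := by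
    intro p hp
    have hs := sin_half_pos (hrange p hp)
    have hc := cos_half_pos (hrange p hp)
    have hG' := hG p hp
    have hsq := Real.sqrt_pos.2 (hE p hp)
    have eF : ⟪dv x p, du x p⟫ = 0 := by rw [real_inner_comm]; exact hF p hp
    have e := h.gamma₂_eq p hp
    have eG : du (coeffG x) p =
        (Real.cos (lam p / 2) * du lam p / Real.sin (lam p / 2)) * coeffG x p := by
      have : du (coeffG x) p = ⟪dv x p, du (dv x) p⟫ + ⟪du (dv x) p, dv x p⟫ :=
        du_inner (dv₀ p hp) (dv₀ p hp)
      rw [this, real_inner_comm (dv x p), hmix p hp, hxuv p hp, inner_add_right,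
        real_inner_smul_right, real_inner_smul_right, eF, coeffG]
      field_simp; ring
    rw [gamma₂, eG] at e
    have hu0 := (mul_ne_zero_iff.1 (hder p hp)).1
    field_simp at e
    linarith
  let X : ℝ × ℝ → E3 := fun p => (Real.cos (lam p / 2))⁻¹ • du x p
  let Y : ℝ × ℝ → E3 := fun p => (Real.sin (lam p / 2))⁻¹ • dv x p
  have hX : ∀ p ∈ D, du x p = Real.cos (lam p / 2) • X p := fun p hp => by
    simp only [X]; rw [smul_inv_smul₀ (cos_half_pos (hrange p hp)).ne']
  have hY : ∀ p ∈ D, dv x p = Real.sin (lam p / 2) • Y p := fun p hp => by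
    simp only [Y]; rw [smul_inv_smul₀ (sin_half_pos (hrange p hp)).ne']
  have hdc := fun p hp => differentiableAt_cos_half (hlam p hp)
  have hds := fun p hp => differentiableAt_sin_half (hlam p hp)
  have hdX : ∀ p ∈ D, DifferentiableAt ℝ X p := fun p hp =>
    ((hdc p hp).fun_inv (cos_half_pos (hrange p hp)).ne').fun_smul (du₀ p hp)
  have hdY : ∀ p ∈ D, DifferentiableAt ℝ Y p := fun p hp =>
    ((hds p hp).fun_inv (sin_half_pos (hrange p hp)).ne').fun_smul (dv₀ p hp)
  have ho : ∀ p ∈ D, IsOrientedFrame (X p) (Y p) (unitNormal x p) := by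
    intro p hp
    have hc := cos_half_pos (hrange p hp)
    have hs := sin_half_pos (hrange p hp)
    have eE : ⟪du x p, du x p⟫ = Real.cos (lam p / 2) ^ 2 := by
      rw [← hsqrtE p hp, Real.sq_sqrt (hE p hp).le]; rfl
    have eG : ⟪dv x p, dv x p⟫ = Real.sin (lam p / 2) ^ 2 := by
      rw [← hsqrtG p hp, Real.sq_sqrt (hG p hp).le]; rfl
    have eF : ⟪du x p, dv x p⟫ = 0 := hF p hp
    have o1 : ⟪X p, X p⟫ = 1 := by
      simp only [X]; rw [real_inner_smul_left, real_inner_smul_right, eE]; field_simp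
    have o2 : ⟪Y p, Y p⟫ = 1 := by
      simp only [Y]; rw [real_inner_smul_left, real_inner_smul_right, eG]; field_simp
    have o3 : ⟪X p, Y p⟫ = 0 := by
      simp only [X, Y]; rw [real_inner_smul_left, real_inner_smul_right, eF]; ring
    exact ⟨o1, o2, o3, unitNormal_eq hc hs ⟨o1, o2, o3, rfl⟩ (hX p hp) (hY p hp)⟩
  have hlu : ∀ p ∈ D, du (unitNormal x) p = -Real.sin (lam p / 2) • X p := fun p hp => by
    have hc := cos_half_pos (hrange p hp)
    rw [hdnu p hp, hX p hp, smul_smul]; congr 1; field_simp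
  have hlv : ∀ p ∈ D, dv (unitNormal x) p = Real.cos (lam p / 2) • Y p := fun p hp => by
    have hs := sin_half_pos (hrange p hp)
    rw [hdnv p hp, hY p hp, smul_smul]; congr 1; field_simp
  -- Expanding x_uv = (cos(λ/2) X)_v, the X-terms cancel against the formula for x_uv and only a
  -- multiple of Y remains.
  have hXv : ∀ p ∈ D, dv X p = (du lam p / 2) • Y p := by
    intro p hp
    have hc := cos_half_pos (hrange p hp)
    have hs := sin_half_pos (hrange p hp)
    have e := dv_congr hD hp hX
    rw [dv_smul (hdc p hp) (hdX p hp), dv_comp (hasDerivAt_cos_half _) (hlam p hp), hxuv p hp,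
      hX p hp, hY p hp, smul_smul, smul_smul] at e
    refine smul_right_injective _ hc.ne' ?_
    simp only
    rw [← sub_eq_iff_eq_add] at e
    rw [← e, smul_smul]
    match_scalars <;> field_simp
    ring
  have hYu : ∀ p ∈ D, du Y p = -(dv lam p / 2) • X p := by
    intro p hp
    have hc := cos_half_pos (hrange p hp)
    have hs := sin_half_pos (hrange p hp)
    have e := du_congr hD hp hY
    rw [du_smul (hds p hp) (hdY p hp), du_comp (hasDerivAt_sin_half _) (hlam p hp), hmix p hp,
      hxuv p hp, hX p hp, hY p hp, smul_smul, smul_smul] at e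
    refine smul_right_injective _ hs.ne' ?_
    simp only
    rw [← sub_eq_iff_eq_add] at e
    rw [← e, smul_smul]
    match_scalars <;> field_simp
    ring
  have hframe : ∀ p ∈ D, ⟪cross (X p) (Y p), unitNormal x p⟫ ≠ 0 := fun p hp => by
    rw [← (ho p hp).eq_cross, (ho p hp).inner_l]; exact one_ne_zero
  refine ⟨X, Y, unitNormal x, ⟨hdX, hdY, dn, fun p hp => ?_, hXv, hYu, fun p hp => ?_, hlu, hlv⟩,
    fun p hp => ⟨ho p hp, hX p hp, hY p hp⟩⟩
  -- X_u is found from its inner products with the frame: the orthonormality relations reduce them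
  -- to Y_u and l_u, already known. The same argument gives Y_v.
  · have e1 := du_congr hD hp (g := fun _ => (1 : ℝ)) fun p hp => (ho p hp).inner_X
    have e2 := du_congr hD hp (g := fun _ => (0 : ℝ)) fun p hp => (ho p hp).inner_XY
    have e3 := du_congr hD hp (g := fun _ => (0 : ℝ)) fun p hp => (ho p hp).inner_Xl
    rw [du_inner (hdX p hp) (hdX p hp), du_const, real_inner_comm] at e1
    rw [du_inner (hdX p hp) (hdY p hp), du_const, hYu p hp, real_inner_smul_right,
      (ho p hp).inner_X] at e2
    rw [du_inner (hdX p hp) (dn p hp), du_const, hlu p hp, real_inner_smul_right,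
      (ho p hp).inner_X] at e3
    refine eq_of_inner_eq (hframe p hp) ?_ ?_ ?_ <;>
    simp only [inner_add_left, real_inner_smul_left, (ho p hp).inner_Y, (ho p hp).inner_l,
      (ho p hp).inner_YX, (ho p hp).inner_lX, (ho p hp).inner_lY, (ho p hp).inner_Yl] <;>
    linarith
  · have e1 := dv_congr hD hp (g := fun _ => (1 : ℝ)) fun p hp => (ho p hp).inner_Y
    have e2 := dv_congr hD hp (g := fun _ => (0 : ℝ)) fun p hp => (ho p hp).inner_YX
    have e3 := dv_congr hD hp (g := fun _ => (0 : ℝ)) fun p hp => (ho p hp).inner_Yl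
    rw [dv_inner (hdY p hp) (hdY p hp), dv_const, real_inner_comm] at e1
    rw [dv_inner (hdY p hp) (hdX p hp), dv_const, hXv p hp, real_inner_smul_right,
      (ho p hp).inner_Y] at e2
    rw [dv_inner (hdY p hp) (dn p hp), dv_const, hlv p hp, real_inner_smul_right,
      (ho p hp).inner_Y] at e3
    refine eq_of_inner_eq (hframe p hp) ?_ ?_ ?_ <;>
    simp only [inner_sub_left, real_inner_smul_left, (ho p hp).inner_X, (ho p hp).inner_l,
      (ho p hp).inner_XY, (ho p hp).inner_lX, (ho p hp).inner_lY, (ho p hp).inner_Xl] <;>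
    linarith

/-- After a rotation A matching the frames at one point, they coincide on D. Then y and A ∘ x have
equal partial derivatives, so on the connected set D they differ by a constant. -/
theorem IsGeneratedBy.exists_motion (hx : IsGeneratedBy 3 lam x D) (hy : IsGeneratedBy 3 lam y D)
    (hD : IsOpen D) (hc : IsConnected D) (hlam : ∀ p ∈ D, DifferentiableAt ℝ lam p)
    (hrange : ∀ p ∈ D, 0 < lam p ∧ lam p < Real.pi / 2)
    (hder : ∀ p ∈ D, du lam p * dv lam p ≠ 0) :
    ∃ T : E3 → E3, IsMotion T ∧ EqOn y (T ∘ x) D := by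
  obtain ⟨X, Y, l, hfr, ho⟩ := hx.exists_isMovingFrame hD hlam hrange hder
  obtain ⟨X', Y', l', hfr', ho'⟩ := hy.exists_isMovingFrame hD hlam hrange hder
  obtain ⟨p₀, hp₀⟩ := hc.nonempty
  obtain ⟨A, hA, aX, aY, al⟩ := exists_isometry_of_isOrientedFrame (ho p₀ hp₀).1 (ho' p₀ hp₀).1
  let A' : E3 →L[ℝ] E3 := A.toContinuousLinearEquiv
  have heq := fun p hp => (hfr.map A').eq_of_eq_at hfr' hD hc.isPreconnected hp₀ aX aY al (p := p) hp
  have hd : ∀ {z : ℝ × ℝ → E3}, IsGeneratedBy 3 lam z D → ∀ p ∈ D, DifferentiableAt ℝ z p :=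
    fun hz p hp => (hz.surface.contDiffOn.differentiableOn (by norm_num)).differentiableAt
      (hD.mem_nhds hp)
  have hdA : ∀ p ∈ D, DifferentiableAt ℝ (fun p => A' (x p)) p := fun p hp =>
    A'.differentiableAt.comp p (hd hx p hp)
  refine ⟨fun a => A a + (y p₀ - A (x p₀)), ⟨A, _, hA, fun _ => rfl⟩, fun p hp => ?_⟩
  have := eq_of_partials_eq_zero (f := fun p => y p - A' (x p)) hD hc.isPreconnected
    (fun p hp => (hd hy p hp).fun_sub (hdA p hp)) (fun p hp => ?_) (fun p hp => ?_) hp hp₀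
  · have e : y p - A (x p) = y p₀ - A (x p₀) := this
    change y p = A (x p) + (y p₀ - A (x p₀))
    rw [← e]; abel
  · rw [du_sub (hd hy p hp) (hdA p hp), du_clm A' (hd hx p hp), (ho p hp).2.1, (ho' p hp).2.1,
      map_smul, (heq p hp).1, sub_self]
  · rw [dv_sub (hd hy p hp) (hdA p hp), dv_clm A' (hd hx p hp), (ho p hp).2.2, (ho' p hp).2.2,
      map_smul, (heq p hp).2, sub_self]

end Uniqueness

end SurfaceTheory

theorem corollary5p6 (n : ℕ∞) (hn : 2 ≤ n) (D : Set (ℝ × ℝ)) (hD : IsOpen D)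
    (lam : ℝ × ℝ → ℝ) (hlam : ContDiffOn ℝ n lam D)
    (hsol : ∀ p ∈ D, SurfaceTheory.hypLaplacian lam p = Real.sin (lam p))
    (hrange : ∀ p ∈ D, 0 < lam p ∧ lam p < Real.pi / 2)
    (hder : ∀ p ∈ D, SurfaceTheory.du lam p * SurfaceTheory.dv lam p ≠ 0) :
    (∀ p₀ ∈ D, ∃ D₀ : Set (ℝ × ℝ), D₀ ⊆ D ∧ IsOpen D₀ ∧ IsConnected D₀ ∧ p₀ ∈ D₀ ∧
      ∃ x : ℝ × ℝ → SurfaceTheory.E3, SurfaceTheory.IsGeneratedBy (n + 1) lam x D₀) ∧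
    (∀ D₀ : Set (ℝ × ℝ), D₀ ⊆ D → IsOpen D₀ → IsConnected D₀ →
      ∀ x : ℝ × ℝ → SurfaceTheory.E3, SurfaceTheory.IsGeneratedBy 3 lam x D₀ →
        ∀ y : ℝ × ℝ → SurfaceTheory.E3, SurfaceTheory.IsGeneratedBy 3 lam y D₀ ↔
          ∃ T : SurfaceTheory.E3 → SurfaceTheory.E3,
            SurfaceTheory.IsMotion T ∧ Set.EqOn y (T ∘ x) D₀) := by
  have hn' : ((2 : ℕ∞) : WithTop ℕ∞) ≤ (n : WithTop ℕ∞) := WithTop.coe_le_coe.2 hn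
  have hn0 : (n : WithTop ℕ∞) ≠ 0 := fun h => by
    rw [h] at hn'; exact absurd hn' (by decide)
  refine ⟨fun p₀ hp₀ => ?_, fun D₀ hsub hD₀ hc x hx y => ⟨fun hy => ?_, ?_⟩⟩
  · obtain ⟨r, hr, hrD, x, hx⟩ :=
      SurfaceTheory.exists_isGeneratedBy hn hD hlam hsol hrange hder hp₀
    exact ⟨Metric.ball p₀ r, hrD, Metric.isOpen_ball,
      (convex_ball p₀ r).isConnected ⟨p₀, Metric.mem_ball_self hr⟩, Metric.mem_ball_self hr, x, hx⟩
  · exact hx.exists_motion hy hD₀ hc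
      (fun p hp => (hlam.differentiableOn hn0).differentiableAt (hD.mem_nhds (hsub hp)))
      (fun p hp => hrange p (hsub hp)) (fun p hp => hder p (hsub hp))
  · rintro ⟨T, hT, hy⟩
    exact hx.comp_motion (by decide) hD₀ hT hy
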